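/- Let $G$ be an undirected connected graph on the node set $\mathcal N=\{1,\dots,N\}$, $N\ge 2$, with adjacency elements in $\{0,1\}$, let $\mathcal N_i$ be the set of neighbours of node $i$, and let $\lambda_2(\mathcal L)$ be the second smallest eigenvalue (counted with multiplicity) of the graph Laplacian $\mathcal L$. Let $z_i\in\mathbb R$ and $s_i\in\{0,1\}$, $i\in\mathcal N$, be given, with $s_i=1$ for at least one $i$. Put $S=|\{i: s_i=1\}|$, let $z^s_1\le\cdots\le z^s_S$ be the values $z_i$ with $s_i=1$ (repetitions kept) in nondecreasing order, and let the median set be $\mathcal M_{\mathcal Z}^{\mathcal S}=\{z^s_{(S+1)/2}\}$ if $S$ is odd and $\mathcal M_{\mathcal Z}^{\mathcal S}=[z^s_{S/2},z^s_{S/2+1}]$ if $S$ is even. Let $\gamma>0$ and consider the distributed median solver $$\dot x_i = s_i\,\mathrm{sgn}(z_i-x_i)+\gamma\sum_{j\in\mathcal N_i}(x_j-x_i),\qquad i\in\mathcal N,$$ with $\mathrm{sgn}(0)=0$. Solutions are understood in the sense of Filippov: $x$ is absolutely continuous on compact subintervals and satisfies $\dot x(t)\in\bigcap_{\delta>0}\bigcap_{|E|=0}\overline{\mathrm{co}}\,f(B(x(t),\delta)\setminus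 E)$ for almost every $t$, where $f$ is the right-hand side and $|E|$ denotes Lebesgue measure. Then from any initial condition in $\mathbb R^N$ there is a solution that exists for all $t\ge 0$; every solution on a bounded interval $[0,T)$ extends to a solution on $[0,\infty)$; and every solution on $[0,\infty)$ satisfies $$\limsup_{t\to\infty}\ \inf_{y\in\mathcal M_{\mathcal Z}^{\mathcal S}}|x_i(t)-y|\ \le\ \frac{2\sqrt N}{\gamma\,\lambda_2(\mathcal L)}\qquad\text{for all } i\in\mathcal N.$$ -/

import Mathlib

open MeasureTheory Filter

noncomputable section

/-- The Filippov set-valued map of a (possibly discontinuous) vector field `f`: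
`K[f](x) = ⋂_{δ > 0} ⋂_{|S| = 0} cl co f (B(x, δ) \ S)`. -/
def filippovMap {E : Type*} [NormedAddCommGroup E] [NormedSpace ℝ E] [MeasureSpace E]
    (f : E → E) (x : E) : Set E :=
  ⋂ (δ : ℝ) (_ : 0 < δ) (S : Set E) (_ : volume S = 0),
    closure (convexHull ℝ (f '' (Metric.ball x δ \ S)))

/-- `x` is a Filippov solution of `ẋ = f(x)` on the interval `I`: it is absolutely continuous on
every compact subinterval of `I`, and `ẋ(t) ∈ K[f](x(t))` for almost every `t ∈ I`. -/
structure IsFilippovSolutionOn {E : Type*} [NormedAddCommGroup E] [NormedSpace ℝ E]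
    [MeasureSpace E] (f : E → E) (x : ℝ → E) (I : Set ℝ) : Prop where
  absolutelyContinuous : ∀ a ∈ I, ∀ b ∈ I, AbsolutelyContinuousOnInterval x a b
  deriv_mem : ∀ᵐ t ∂(volume.restrict I), ∃ v ∈ filippovMap f (x t), HasDerivAt x v t

/-- The right-hand side of the distributed median solver
`ẋ_i = s_i sgn(z_i - x_i) + γ ∑_{j ∈ N_i} (x_j - x_i)`. -/
def medianSolver {V : Type*} [Fintype V] (G : SimpleGraph V) [DecidableRel G.Adj]
    (s z : V → ℝ) (γ : ℝ) (x : V → ℝ) : V → ℝ :=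
  fun i => s i * Real.sign (z i - x i) + γ * ∑ j ∈ G.neighborFinset i, (x j - x i)

/-- The list, in nondecreasing order and with repetitions, of the values `z i` with `s i = 1`. -/
def sortedIndicated {V : Type*} [Fintype V] (s z : V → ℝ) : List ℝ :=
  ((Finset.univ.filter fun i => s i = 1).val.map z).sort (· ≤ ·)

/-- The set of medians of the indicated values (list positions start at `0`; when there is at
least one indicated value the default value of `getD` is never used). -/
def medianSet {V : Type*} [Fintype V] (s z : V → ℝ) : Set ℝ :=
  if Odd (sortedIndicated s z).length then
    {(sortedIndicated s z).getD (((sortedIndicated s z).length + 1) / 2 - 1) 0}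
  else
    Set.Icc ((sortedIndicated s z).getD ((sortedIndicated s z).length / 2 - 1) 0)
      ((sortedIndicated s z).getD ((sortedIndicated s z).length / 2) 0)

/-- The algebraic connectivity `λ₂`: the second smallest eigenvalue, counted with multiplicity, of
the graph Laplacian. (`eigenvalues₀` lists the eigenvalues in nonincreasing order.) -/
def algebraicConnectivity {V : Type*} [Fintype V] [DecidableEq V] (G : SimpleGraph V)
    [DecidableRel G.Adj] (hV : 2 ≤ Fintype.card V) : ℝ :=
  (G.isHermitian_lapMatrix (R := ℝ)).eigenvalues₀
    ⟨Fintype.card V - 2, Nat.sub_lt (lt_of_lt_of_le Nat.zero_lt_two hV) Nat.zero_lt_two⟩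

end

/-!
# The distributed median solver

With `A x = -γ L x` the consensus term, the Filippov map of the solver is exactly the set of vectors
`s p + A x` with `p i` in the set-valued sign of `z i - x i` (`filippovMap_medianSolver`). The
set-valued sign is monotone and `A` is dissipative, so the Euclidean distance of two solutions does
not increase: solutions are unique (`eqOn_of_isFilippovSolutionOn`), and every solution on `[0, T)`
is the restriction of a global one as soon as global solutions exist (`exists_extension`).

For existence the sign is replaced by its Yosida approximation, the saturation `sat (κ u)`, which
gives a Lipschitz equation. The same dissipativity estimate, now with an error of order
`1 / κ + 1 / μ`, shows that the approximate solutions form a locally uniformly Cauchy family, and the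
limit is locally Lipschitz. Since the Filippov set is described by inequalities on the
components, its closedness under such limits reduces to a bound on the increments of one component
(`apply_le_of_hasDerivAt_of_tendsto`).

For the asymptotic bound, let `m` be the mean of the components and `N` the number of nodes. Since
`⟨e, A e⟩ ≤ -γ λ₂ |e|²` for vectors `e` of mean zero (`sum_mul_consensus_le`) while the sign terms
have Euclidean norm at most `√N`, the disagreement `|x - m|` is eventually below any
`c > √N / (γ λ₂)` (`eventually_sum_sub_mean_sq_le`). The consensus term does not act on `m`, so
`m' = (∑ s p) / N`. When `m` is more than `c` above the median set, all nodes are above it, more than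
half of the active signs are `-1`, and `m' ≤ -1 / N`; symmetrically below. Hence `m` is eventually
within `c` of the median set (`eventually_mean_mem`) and each node within `2 c`.
-/

namespace MedianSolver

open Set Topology Matrix
open scoped NNReal

/-! ### The Laplacian and the algebraic connectivity -/

section Laplacian

variable {V : Type*} [Fintype V] [DecidableEq V] (G : SimpleGraph V) [DecidableRel G.Adj]

lemma lapMatrix_dotProduct_comm (x y : V → ℝ) :
    x ⬝ᵥ (G.lapMatrix ℝ *ᵥ y) = (G.lapMatrix ℝ *ᵥ x) ⬝ᵥ y := by
  rw [dotProduct_mulVec, ← mulVec_transpose, (G.isSymm_lapMatrix (R := ℝ)).eq]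

lemma dotProduct_lapMatrix_mulVec_nonneg (x : V → ℝ) : 0 ≤ x ⬝ᵥ (G.lapMatrix ℝ *ᵥ x) := by
  simpa using (G.posSemidef_lapMatrix ℝ).dotProduct_mulVec_nonneg x

lemma sum_lapMatrix_mulVec (x : V → ℝ) : ∑ i, (G.lapMatrix ℝ *ᵥ x) i = 0 := by
  have h := lapMatrix_dotProduct_comm G (fun _ => 1) x
  rw [G.lapMatrix_mulVec_const_eq_zero] at h
  simpa [dotProduct] using h

/-- A function with vanishing Laplacian on a connected graph is constant. -/
lemma eq_of_lapMatrix_mulVec_eq_zero {G : SimpleGraph V} [DecidableRel G.Adj] (hG : G.Connected)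
    {x : V → ℝ} (hx : G.lapMatrix ℝ *ᵥ x = 0) (i j : V) : x i = x j :=
  (G.lapMatrix_mulVec_eq_zero_iff_forall_reachable).1 hx i j (hG.preconnected i j)

/-- Parseval's identity for the eigenbasis of the Laplacian. -/
lemma sum_dotProduct_eigenvectorBasis (x y : V → ℝ) :
    ∑ k, (x ⬝ᵥ ⇑((G.isHermitian_lapMatrix (R := ℝ)).eigenvectorBasis k)) *
      (⇑((G.isHermitian_lapMatrix (R := ℝ)).eigenvectorBasis k) ⬝ᵥ y) = x ⬝ᵥ y := by
  have h := (G.isHermitian_lapMatrix (R := ℝ)).eigenvectorBasis.sum_inner_mul_inner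
    (WithLp.toLp 2 x) (WithLp.toLp 2 y)
  simpa [EuclideanSpace.inner_eq_star_dotProduct, dotProduct_comm] using h

lemma dotProduct_eigenvectorBasis_self (k : V) :
    ⇑((G.isHermitian_lapMatrix (R := ℝ)).eigenvectorBasis k) ⬝ᵥ
      ⇑((G.isHermitian_lapMatrix (R := ℝ)).eigenvectorBasis k) = 1 := by
  have h := real_inner_self_eq_norm_sq ((G.isHermitian_lapMatrix (R := ℝ)).eigenvectorBasis k)
  rw [(G.isHermitian_lapMatrix (R := ℝ)).eigenvectorBasis.orthonormal.1 k,
    EuclideanSpace.inner_eq_star_dotProduct, star_trivial, one_pow] at h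
  exact h

lemma dotProduct_eigenvectorBasis_of_ne {k l : V} (hkl : k ≠ l) :
    ⇑((G.isHermitian_lapMatrix (R := ℝ)).eigenvectorBasis k) ⬝ᵥ
      ⇑((G.isHermitian_lapMatrix (R := ℝ)).eigenvectorBasis l) = 0 := by
  have h := (G.isHermitian_lapMatrix (R := ℝ)).eigenvectorBasis.orthonormal.inner_eq_zero hkl
  simpa [EuclideanSpace.inner_eq_star_dotProduct, dotProduct_comm] using h

/-- All the eigenvalues except one, listed last, are at least `λ₂`. -/
lemma exists_forall_ne_algebraicConnectivity_le (hV : 2 ≤ Fintype.card V) :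
    ∃ k₀ k₁ : V, k₁ ≠ k₀ ∧
      (G.isHermitian_lapMatrix (R := ℝ)).eigenvalues k₁ = algebraicConnectivity G hV ∧
      (G.isHermitian_lapMatrix (R := ℝ)).eigenvalues k₀ ≤ algebraicConnectivity G hV ∧
      ∀ k, k ≠ k₀ →
        algebraicConnectivity G hV ≤ (G.isHermitian_lapMatrix (R := ℝ)).eigenvalues k := by
  set e : Fin (Fintype.card V) ≃ V := Fintype.equivOfCardEq (Fintype.card_fin _) with he
  have hanti := (G.isHermitian_lapMatrix (R := ℝ)).eigenvalues₀_antitone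
  refine ⟨e ⟨Fintype.card V - 1, by omega⟩, e ⟨Fintype.card V - 2, by omega⟩, ?_, ?_, ?_, ?_⟩
  · intro h
    have := congrArg Fin.val (e.injective h)
    simp only at this
    omega
  · simp [IsHermitian.eigenvalues, algebraicConnectivity, ← he]
  · simp only [IsHermitian.eigenvalues, algebraicConnectivity, ← he, Equiv.symm_apply_apply]
    refine hanti (Fin.le_def.2 ?_)
    simp only
    omega
  · intro k hk
    refine hanti (Fin.le_def.2 ?_)
    have h1 : (e.symm k).val ≠ Fintype.card V - 1 := by
      intro h
      exact hk (by rw [← e.apply_symm_apply k]; congr 1; exact Fin.ext h)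
    have h2 := (e.symm k).isLt
    change (e.symm k).val ≤ Fintype.card V - 2
    omega

lemma algebraicConnectivity_pos (hV : 2 ≤ Fintype.card V) (hG : G.Connected) :
    0 < algebraicConnectivity G hV := by
  obtain ⟨k₀, k₁, hne, h₁, h₀, -⟩ := exists_forall_ne_algebraicConnectivity_le G hV
  have hnn : ∀ k, 0 ≤ (G.isHermitian_lapMatrix (R := ℝ)).eigenvalues k :=
    fun k => (G.posSemidef_lapMatrix ℝ).eigenvalues_nonneg k
  refine lt_of_le_of_ne (h₁ ▸ hnn k₁) fun h => ?_
  -- if `λ₂ = 0` then two orthogonal eigenvectors are constant functions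
  have hconst : ∀ k, (G.isHermitian_lapMatrix (R := ℝ)).eigenvalues k = 0 → ∃ c : ℝ,
      ⇑((G.isHermitian_lapMatrix (R := ℝ)).eigenvectorBasis k) = fun _ => c := by
    intro k hk
    have := (G.isHermitian_lapMatrix (R := ℝ)).mulVec_eigenvectorBasis k
    rw [hk, zero_smul] at this
    exact ⟨_, funext fun i => eq_of_lapMatrix_mulVec_eq_zero hG this i k⟩
  obtain ⟨c₀, hc₀⟩ := hconst k₀ (le_antisymm (h₀.trans h.ge) (hnn k₀))
  obtain ⟨c₁, hc₁⟩ := hconst k₁ (h₁.trans h.symm)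
  have e₀ := dotProduct_eigenvectorBasis_self G k₀
  have e₁ := dotProduct_eigenvectorBasis_self G k₁
  have e₂ := dotProduct_eigenvectorBasis_of_ne G hne
  rw [hc₀] at e₀ e₂
  rw [hc₁] at e₁ e₂
  simp only [dotProduct, Finset.sum_const, Finset.card_univ, nsmul_eq_mul] at e₀ e₁ e₂
  have : (1 : ℝ) * 1 = 0 * 0 := by
    rw [← e₂]; nth_rewrite 1 [← e₁, ← e₀]; ring
  norm_num at this

/-- The Courant–Fischer bound: on the orthogonal complement of the constants the quadratic form of
the Laplacian is bounded below by `λ₂`. -/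
lemma algebraicConnectivity_mul_le (hV : 2 ≤ Fintype.card V) (hG : G.Connected) {x : V → ℝ}
    (hx : ∑ i, x i = 0) :
    algebraicConnectivity G hV * ∑ i, x i ^ 2 ≤ x ⬝ᵥ (G.lapMatrix ℝ *ᵥ x) := by
  obtain ⟨k₀, -, -, -, -, hle⟩ := exists_forall_ne_algebraicConnectivity_le G hV
  have hpos := algebraicConnectivity_pos G hV hG
  set b : V → V → ℝ := fun k => ⇑((G.isHermitian_lapMatrix (R := ℝ)).eigenvectorBasis k) with hb
  set μ := (G.isHermitian_lapMatrix (R := ℝ)).eigenvalues with hμ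
  have hLb : ∀ k, G.lapMatrix ℝ *ᵥ b k = μ k • b k :=
    (G.isHermitian_lapMatrix (R := ℝ)).mulVec_eigenvectorBasis
  have parseval : ∀ x y : V → ℝ, ∑ k, (x ⬝ᵥ b k) * (b k ⬝ᵥ y) = x ⬝ᵥ y :=
    sum_dotProduct_eigenvectorBasis G
  have hone : ∀ k, k ≠ k₀ → (fun _ => (1 : ℝ)) ⬝ᵥ b k = 0 := by
    intro k hk
    have h := lapMatrix_dotProduct_comm G (fun _ => 1) (b k)
    rw [G.lapMatrix_mulVec_const_eq_zero, hLb, dotProduct_smul, zero_dotProduct, smul_eq_mul] at h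
    exact (mul_eq_zero.1 h).resolve_left (hpos.trans_le (hle k hk)).ne'
  have hsingle : ∀ y : V → ℝ,
      ((fun _ => (1 : ℝ)) ⬝ᵥ b k₀) * (b k₀ ⬝ᵥ y) = (fun _ => (1 : ℝ)) ⬝ᵥ y := by
    intro y
    rw [← parseval (fun _ => 1) y, Finset.sum_eq_single k₀ (fun k _ hk => by rw [hone k hk, zero_mul]) (by simp)]
  have hbx : b k₀ ⬝ᵥ x = 0 := by
    have h1 := hsingle x
    have h2 := hsingle fun _ => 1
    have hcard : (0 : ℝ) < Fintype.card V := by exact_mod_cast (by omega : 0 < Fintype.card V)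
    have h3 : (fun _ : V => (1 : ℝ)) ⬝ᵥ x = 0 := by simpa [dotProduct] using hx
    have h4 : (fun _ : V => (1 : ℝ)) ⬝ᵥ (fun _ => 1) = Fintype.card V := by simp [dotProduct]
    rw [h3] at h1
    refine (mul_eq_zero.1 h1).resolve_left fun h => ?_
    rw [h, zero_mul, h4] at h2
    exact hcard.ne h2
  have e1 : ∑ i, x i ^ 2 = ∑ k, (b k ⬝ᵥ x) ^ 2 := by
    have : ∑ i, x i ^ 2 = x ⬝ᵥ x := by simp [dotProduct, sq]
    rw [this, ← parseval]
    exact Finset.sum_congr rfl fun k _ => by rw [dotProduct_comm x, sq]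
  have e2 : x ⬝ᵥ (G.lapMatrix ℝ *ᵥ x) = ∑ k, μ k * (b k ⬝ᵥ x) ^ 2 := by
    rw [← parseval]
    refine Finset.sum_congr rfl fun k _ => ?_
    rw [lapMatrix_dotProduct_comm, hLb, smul_dotProduct, dotProduct_comm x, smul_eq_mul]
    ring
  rw [e1, e2, Finset.mul_sum]
  refine Finset.sum_le_sum fun k _ => ?_
  rcases eq_or_ne k k₀ with rfl | hk
  · simp [hbx]
  · exact mul_le_mul_of_nonneg_right (hle k hk) (sq_nonneg _)

/-- The consensus term `x ↦ (γ ∑_{j ∈ N_i} (x_j - x_i))_i = -γ L x` as a continuous linear map. -/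
noncomputable def consensus (γ : ℝ) : (V → ℝ) →L[ℝ] (V → ℝ) :=
  LinearMap.toContinuousLinearMap ((-γ) • (G.lapMatrix ℝ).mulVecLin)

lemma consensus_eq (γ : ℝ) (x : V → ℝ) : consensus G γ x = (-γ) • (G.lapMatrix ℝ *ᵥ x) := rfl

lemma consensus_apply (γ : ℝ) (x : V → ℝ) (i : V) :
    consensus G γ x i = γ * ∑ j ∈ G.neighborFinset i, (x j - x i) := by
  rw [consensus_eq, Pi.smul_apply, SimpleGraph.lapMatrix_mulVec_apply, Finset.sum_sub_distrib,
    Finset.sum_const, G.card_neighborFinset_eq_degree, nsmul_eq_mul, smul_eq_mul]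
  ring

lemma sum_consensus (γ : ℝ) (x : V → ℝ) : ∑ i, consensus G γ x i = 0 := by
  simp only [consensus_eq, Pi.smul_apply, ← Finset.smul_sum, sum_lapMatrix_mulVec, smul_zero]

lemma consensus_const (γ c : ℝ) : consensus G γ (fun _ => c) = 0 := by
  ext i
  simp [consensus_apply]

/-- The consensus term is dissipative. -/
lemma sum_mul_consensus_nonpos {γ : ℝ} (hγ : 0 < γ) (x : V → ℝ) :
    ∑ i, x i * consensus G γ x i ≤ 0 := by
  have h := dotProduct_lapMatrix_mulVec_nonneg G x
  have : ∑ i, x i * consensus G γ x i = -γ * (x ⬝ᵥ (G.lapMatrix ℝ *ᵥ x)) := by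
    rw [← smul_eq_mul (-γ), ← dotProduct_smul]; rfl
  rw [this]
  nlinarith

/-- On vectors of mean zero the consensus term is strongly dissipative, with rate `γ λ₂`. -/
lemma sum_mul_consensus_le {γ : ℝ} (hγ : 0 < γ) (hV : 2 ≤ Fintype.card V) (hG : G.Connected)
    {x : V → ℝ} (hx : ∑ i, x i = 0) :
    ∑ i, x i * consensus G γ x i ≤ -(γ * algebraicConnectivity G hV) * ∑ i, x i ^ 2 := by
  have h := algebraicConnectivity_mul_le G hV hG hx
  have : ∑ i, x i * consensus G γ x i = -γ * (x ⬝ᵥ (G.lapMatrix ℝ *ᵥ x)) := by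
    rw [← smul_eq_mul (-γ), ← dotProduct_smul]; rfl
  rw [this]
  nlinarith

end Laplacian

/-! ### The set-valued sign -/

/-- The maximal monotone sign: `{1}` for `u > 0`, `{-1}` for `u < 0` and `[-1, 1]` for `u = 0`. -/
def signSet (u : ℝ) : Set ℝ := {p | |p| ≤ 1 ∧ (0 < u → p = 1) ∧ (u < 0 → p = -1)}

lemma sign_mem_signSet (u : ℝ) : Real.sign u ∈ signSet u := by
  rcases lt_trichotomy u 0 with h | h | h
  · simp [signSet, Real.sign_of_neg h, h, h.le]
  · simp [signSet, h]
  · simp [signSet, Real.sign_of_pos h, h, h.le]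

lemma signSet_monotone {a b p q : ℝ} (hp : p ∈ signSet a) (hq : q ∈ signSet b) :
    (b - a) * (p - q) ≤ 0 := by
  obtain ⟨hp1, hp2, hp3⟩ := hp
  obtain ⟨hq1, hq2, hq3⟩ := hq
  rw [abs_le] at hp1 hq1
  rcases lt_trichotomy a b with h | h | h
  · suffices p ≤ q by nlinarith
    rcases lt_or_ge a 0 with h' | h'
    · rw [hp3 h']; exact hq1.1
    · rw [hq2 (h'.trans_lt h)]; exact hp1.2
  · simp [h]
  · suffices q ≤ p by nlinarith
    rcases lt_or_ge b 0 with h' | h'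
    · rw [hq3 h']; exact hp1.1
    · rw [hp2 (h'.trans_lt h)]; exact hq1.2

lemma signSet_subset_convexHull (u : ℝ) :
    signSet u ⊆ convexHull ℝ {e | |e| = 1 ∧ e ∈ signSet u} := by
  intro p hp
  by_cases h1 : |p| = 1
  · exact subset_convexHull _ _ ⟨h1, hp⟩
  -- only for `u = 0` is there an interior value `p`, which lies between `-1` and `1`
  have hu : u = 0 := by
    by_contra hu
    rcases lt_or_gt_of_ne hu with h | h
    · exact h1 (by simp [hp.2.2 h])
    · exact h1 (by simp [hp.2.1 h])
  subst hu
  have hp' := abs_le.1 hp.1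
  have hseg : p ∈ segment ℝ (-1 : ℝ) 1 := by
    rw [segment_eq_Icc (by norm_num)]; exact hp'
  refine segment_subset_convexHull ?_ ?_ hseg <;> simp [signSet]

/-! ### The Filippov set-valued map of the solver -/

/-- A linear functional that is bounded above on the values of `f` near `x` by a function `g`
continuous at `x` is bounded by `g x` on the Filippov set. -/
lemma apply_le_of_mem_filippovMap {E : Type*} [NormedAddCommGroup E] [NormedSpace ℝ E]
    [MeasureSpace E] {f : E → E} {x v : E} (hv : v ∈ filippovMap f x) (l : E →L[ℝ] ℝ) {g : E → ℝ}
    (hg : ContinuousAt g x) (hfg : ∀ᶠ y in 𝓝 x, l (f y) ≤ g y) : l v ≤ g x := by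
  refine le_of_forall_pos_le_add fun η hη => ?_
  have h1 : ∀ᶠ y in 𝓝 x, l (f y) ≤ g x + η := by
    filter_upwards [hfg, hg.eventually_lt_const (lt_add_of_pos_right _ hη)] with y h2 h3
      using h2.trans h3.le
  obtain ⟨δ, hδ, hball⟩ := Metric.eventually_nhds_iff_ball.1 h1
  simp only [filippovMap, mem_iInter] at hv
  suffices h : closure (convexHull ℝ (f '' (Metric.ball x δ \ ∅))) ⊆ {w | l w ≤ g x + η} from
    h (hv δ hδ ∅ measure_empty)
  refine closure_minimal (convexHull_min ?_ ?_) ?_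
  · rintro _ ⟨y, hy, rfl⟩
    exact hball y hy.1
  · exact convex_halfSpace_le l.isLinear _
  · exact isClosed_le l.continuous continuous_const

section Solver

variable {V : Type*} [Fintype V] [DecidableEq V] (G : SimpleGraph V) [DecidableRel G.Adj]
  {s z : V → ℝ} {γ : ℝ}

/-- The right-hand side of the solver with `sgn` replaced by the set-valued sign. -/
def solverSet (s z : V → ℝ) (γ : ℝ) (x : V → ℝ) : Set (V → ℝ) :=
  {v | ∃ p : V → ℝ, (∀ i, p i ∈ signSet (z i - x i)) ∧
    ∀ i, v i = s i * p i + consensus G γ x i}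

lemma medianSolver_apply (x : V → ℝ) (i : V) :
    medianSolver G s z γ x i = s i * Real.sign (z i - x i) + consensus G γ x i := by
  rw [consensus_apply]; rfl

variable {G}

/-- Membership in `solverSet` from one-sided bounds on the components. -/
lemma mem_solverSet_of_le (hs : ∀ i, s i = 0 ∨ s i = 1) {x v : V → ℝ}
    (h1 : ∀ i, v i ≤ s i + consensus G γ x i) (h2 : ∀ i, -v i ≤ s i - consensus G γ x i)
    (h3 : ∀ i, z i < x i → v i ≤ -s i + consensus G γ x i)
    (h4 : ∀ i, x i < z i → -v i ≤ -s i - consensus G γ x i) : v ∈ solverSet G s z γ x := by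
  have key : ∀ i, ∃ p ∈ signSet (z i - x i), v i = s i * p + consensus G γ x i := by
    intro i
    have h1 := h1 i
    have h2 := h2 i
    have h3 := h3 i
    have h4 := h4 i
    rcases hs i with h | h <;> rw [h] at h1 h2 h3 h4 ⊢
    · exact ⟨_, sign_mem_signSet (z i - x i), by linarith⟩
    · refine ⟨v i - consensus G γ x i, ⟨abs_le.2 ⟨by linarith, by linarith⟩, fun h' => ?_,
        fun h' => ?_⟩, by ring⟩
      · have := h4 (by linarith)
        linarith
      · have := h3 (by linarith)
        linarith
  choose p hp hv using key
  exact ⟨p, hp, hv⟩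

lemma mem_solverSet_of_mem_filippovMap (hs : ∀ i, s i = 0 ∨ s i = 1) {x v : V → ℝ}
    (hv : v ∈ filippovMap (medianSolver G s z γ) x) : v ∈ solverSet G s z γ x := by
  have hs0 : ∀ i, 0 ≤ s i := fun i => by rcases hs i with h | h <;> simp [h]
  have habs : ∀ i (y : V → ℝ), |Real.sign (z i - y i)| ≤ 1 := fun i y => (sign_mem_signSet _).1
  refine mem_solverSet_of_le hs (fun i => ?_) (fun i => ?_) (fun i hi => ?_) (fun i hi => ?_)
  · refine apply_le_of_mem_filippovMap hv (ContinuousLinearMap.proj i)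
      (g := fun y => s i + consensus G γ y i) (by fun_prop) (Eventually.of_forall fun y => ?_)
    simp only [ContinuousLinearMap.proj_apply, medianSolver_apply]
    have := (abs_le.1 (habs i y)).2
    nlinarith [hs0 i]
  · refine apply_le_of_mem_filippovMap hv (-ContinuousLinearMap.proj i)
      (g := fun y => s i - consensus G γ y i) (by fun_prop) (Eventually.of_forall fun y => ?_)
    simp only [_root_.neg_apply, ContinuousLinearMap.proj_apply, medianSolver_apply]
    have := (abs_le.1 (habs i y)).1
    nlinarith [hs0 i]
  · refine apply_le_of_mem_filippovMap hv (ContinuousLinearMap.proj i)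
      (g := fun y => -s i + consensus G γ y i) (by fun_prop) ?_
    filter_upwards [continuousAt_const.eventually_lt (continuous_apply i).continuousAt hi] with y hy
    simp only [ContinuousLinearMap.proj_apply, medianSolver_apply]
    rw [Real.sign_of_neg (by linarith)]
    linarith
  · refine apply_le_of_mem_filippovMap hv (-ContinuousLinearMap.proj i)
      (g := fun y => -s i - consensus G γ y i) (by fun_prop) ?_
    filter_upwards [(continuous_apply i).continuousAt.eventually_lt continuousAt_const hi] with y hy
    simp only [_root_.neg_apply, ContinuousLinearMap.proj_apply, medianSolver_apply]
    rw [Real.sign_of_pos (by linarith)]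
    linarith

/-- Every choice of extreme signs `±1` admissible at `x` is realised by `f` on an open set that
has `x` in its closure, so null sets do not remove it. -/
lemma extreme_mem_closure {x e : V → ℝ} (he : ∀ i, |e i| = 1 ∧ e i ∈ signSet (z i - x i))
    {δ : ℝ} (hδ : 0 < δ) {S : Set (V → ℝ)} (hS : volume S = 0) :
    (fun i => s i * e i + consensus G γ x i) ∈
      closure (medianSolver G s z γ '' (Metric.ball x δ \ S)) := by
  set U : Set (V → ℝ) := {y | ∀ i, 0 < e i * (z i - y i)} with hU
  have hUo : IsOpen U := by
    simp only [hU, ofPred_forall]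
    exact isOpen_iInter_of_finite fun i => isOpen_lt continuous_const (by fun_prop)
  have he2 : ∀ i, e i * e i = 1 := fun i => by rw [← abs_mul_abs_self, (he i).1, one_mul]
  have hxU : x ∈ closure U := by
    have hlim : Tendsto (fun τ : ℝ => fun i => x i - τ * e i) (𝓝[>] 0) (𝓝 x) := by
      have : Continuous (fun τ : ℝ => fun i => x i - τ * e i) := by fun_prop
      have h := this.tendsto 0
      simp only [zero_mul, sub_zero] at h
      exact h.mono_left nhdsWithin_le_nhds
    refine mem_closure_of_tendsto hlim ?_
    filter_upwards [self_mem_nhdsWithin] with τ hτ i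
    have h0 : 0 ≤ e i * (z i - x i) := by
      obtain ⟨-, -, hp, hn⟩ := he i
      rcases lt_trichotomy (z i - x i) 0 with h | h | h
      · rw [hn h]; linarith
      · simp [h]
      · rw [hp h]; linarith
    have : e i * (z i - (x i - τ * e i)) = e i * (z i - x i) + τ := by
      linear_combination τ * he2 i
    rw [this]
    exact add_pos_of_nonneg_of_pos h0 hτ
  have hdense : Dense Sᶜ := Measure.dense_of_ae (μ := volume) (p := fun y => y ∉ S)
    (by rw [ae_iff]; simpa using hS)
  have hx : x ∈ closure ((Metric.ball x δ ∩ U) ∩ Sᶜ) := by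
    have h1 : x ∈ closure (Metric.ball x δ ∩ U) :=
      Metric.isOpen_ball.inter_closure ⟨Metric.mem_ball_self hδ, hxU⟩
    exact closure_minimal (hdense.open_subset_closure_inter (Metric.isOpen_ball.inter hUo))
      isClosed_closure h1
  have hcont : Continuous fun y : V → ℝ => fun i => s i * e i + consensus G γ y i := by fun_prop
  refine closure_mono ?_ (image_closure_subset_closure_image hcont ⟨x, hx, rfl⟩)
  rintro _ ⟨y, ⟨⟨hyB, hyU⟩, hyS⟩, rfl⟩
  refine ⟨y, ⟨hyB, hyS⟩, funext fun i => ?_⟩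
  have h := hyU i
  change medianSolver G s z γ y i = s i * e i + consensus G γ y i
  rw [medianSolver_apply]
  rcases eq_or_eq_neg_of_abs_eq (he i).1 with h' | h' <;> rw [h'] at h ⊢
  · rw [Real.sign_of_pos (by linarith)]
  · rw [Real.sign_of_neg (by linarith)]

lemma mem_filippovMap_of_mem_solverSet {x v : V → ℝ} (hv : v ∈ solverSet G s z γ x) :
    v ∈ filippovMap (medianSolver G s z γ) x := by
  obtain ⟨p, hp, hv⟩ := hv
  simp only [filippovMap, mem_iInter]
  intro δ hδ S hS
  set C := closure (convexHull ℝ (medianSolver G s z γ '' (Metric.ball x δ \ S)))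
  have hC : Convex ℝ C := (convex_convexHull ℝ _).closure
  have hconv : Convex ℝ {p : V → ℝ | (fun i => s i * p i + consensus G γ x i) ∈ C} := by
    intro p hp q hq a b ha hb hab
    have h := hC hp hq ha hb hab
    refine (congrArg (· ∈ C) (funext fun i => ?_)).mp h
    simp only [Pi.add_apply, Pi.smul_apply, smul_eq_mul]
    linear_combination consensus G γ x i * hab
  have hpi : p ∈ convexHull ℝ
      (univ.pi fun i => {e | |e| = 1 ∧ e ∈ signSet (z i - x i)}) :=
    mem_convexHull_pi fun i _ => signSet_subset_convexHull _ (hp i)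
  rw [show v = fun i => s i * p i + consensus G γ x i from funext hv]
  refine convexHull_min (fun e he => ?_) hconv hpi
  exact closure_mono (subset_convexHull ℝ _) (extreme_mem_closure (fun i => he i trivial) hδ hS)

/-- The Filippov map of the solver is obtained by replacing `sgn` by the set-valued sign. -/
theorem filippovMap_medianSolver (hs : ∀ i, s i = 0 ∨ s i = 1) (x : V → ℝ) :
    filippovMap (medianSolver G s z γ) x = solverSet G s z γ x :=
  Subset.antisymm (fun _ => mem_solverSet_of_mem_filippovMap hs)
    fun _ => mem_filippovMap_of_mem_solverSet

end Solver

/-! ### Absolutely continuous functions -/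

lemma absolutelyContinuousOnInterval_eval {ι : Type*} [Fintype ι] {x : ℝ → ι → ℝ} {a b : ℝ}
    (hx : AbsolutelyContinuousOnInterval x a b) (i : ι) :
    AbsolutelyContinuousOnInterval (fun t => x t i) a b := by
  refine squeeze_zero (fun E => Finset.sum_nonneg fun _ _ => dist_nonneg) (fun E => ?_) hx
  exact Finset.sum_le_sum fun k _ => dist_le_pi_dist _ _ i

lemma absolutelyContinuousOnInterval_const {X : Type*} [PseudoMetricSpace X] (c : X) (a b : ℝ) :
    AbsolutelyContinuousOnInterval (fun _ => c) a b := by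
  simpa [AbsolutelyContinuousOnInterval] using tendsto_const_nhds

lemma absolutelyContinuousOnInterval_sum {ι : Type*} (S : Finset ι) {u : ι → ℝ → ℝ} {a b : ℝ}
    (hu : ∀ i, AbsolutelyContinuousOnInterval (u i) a b) :
    AbsolutelyContinuousOnInterval (fun t => ∑ i ∈ S, u i t) a b := by
  classical
  induction S using Finset.induction_on with
  | empty => simpa using absolutelyContinuousOnInterval_const (0 : ℝ) a b
  | insert i S hi ih =>
    simp only [Finset.sum_insert hi]
    exact (hu i).fun_add ih

/-- An upper bound for the derivative almost everywhere bounds the increment of an absolutely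
continuous function. -/
lemma sub_le_of_ae_deriv_le {u : ℝ → ℝ} {a b c : ℝ} (hab : a ≤ b)
    (hu : AbsolutelyContinuousOnInterval u a b)
    (hd : ∀ᵐ t, t ∈ Ioc a b → ∃ d ≤ c, HasDerivAt u d t) : u b - u a ≤ c * (b - a) := by
  rw [← hu.integral_deriv_eq_sub, intervalIntegral.integral_of_le hab]
  have h1 : IntegrableOn (deriv u) (Ioc a b) :=
    (intervalIntegrable_iff_integrableOn_Ioc_of_le hab).1 hu.intervalIntegrable_deriv
  have h2 : IntegrableOn (fun _ => c) (Ioc a b) := integrableOn_const (by simp)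
  have h3 : ∫ t in Ioc a b, deriv u t ≤ ∫ _ in Ioc a b, c := by
    refine integral_mono_ae h1 h2 ((ae_restrict_iff' measurableSet_Ioc).2 ?_)
    filter_upwards [hd] with t ht hmem
    obtain ⟨d, hdc, hd⟩ := ht hmem
    rwa [hd.deriv]
  refine h3.trans (le_of_eq ?_)
  simp [hab, mul_comm]

/-- A function that decreases at a rate bounded away from zero as long as it exceeds `c` is
eventually at most `c`. -/
lemma eventually_le_of_ae_decreasing {u : ℝ → ℝ} {c κ t₀ : ℝ} (hκ : 0 < κ)
    (hu : ∀ a b, t₀ ≤ a → t₀ ≤ b → AbsolutelyContinuousOnInterval u a b)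
    (hd : ∀ᵐ t, t₀ ≤ t → c < u t → ∃ d ≤ -κ, HasDerivAt u d t) :
    ∀ᶠ t in atTop, u t ≤ c := by
  have key : ∀ a b, t₀ ≤ a → a ≤ b → (∀ t ∈ Ioc a b, c < u t) → u b - u a ≤ -κ * (b - a) := by
    intro a b ha hab h
    refine sub_le_of_ae_deriv_le hab (hu a b ha (ha.trans hab)) ?_
    filter_upwards [hd] with t ht hmem
    exact ht (ha.trans hmem.1.le) (h t hmem)
  obtain ⟨t₁, ht₁, hut₁⟩ : ∃ t₁, t₀ ≤ t₁ ∧ u t₁ ≤ c := by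
    by_contra! hcon
    set b := t₀ + (u t₀ - c) / κ with hb
    have h0 : t₀ ≤ b := by
      have := div_nonneg (sub_nonneg.2 (hcon t₀ le_rfl).le) hκ.le
      linarith
    have h1 := key t₀ b le_rfl h0 fun t ht => hcon t ht.1.le
    have h2 : -κ * (b - t₀) = -(u t₀ - c) := by rw [hb]; field_simp; ring
    have h3 := hcon b h0
    linarith
  filter_upwards [eventually_ge_atTop t₁] with t ht
  by_contra! hct
  -- `τ` is the last time before `t` at which `u ≤ c`
  set S := {r ∈ Icc t₁ t | u r ≤ c} with hS
  have hcont : ContinuousOn u (Icc t₁ t) := by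
    have := (hu t₁ t ht₁ (ht₁.trans ht)).continuousOn
    rwa [uIcc_of_le ht] at this
  have hScl : IsClosed S := by
    have := hcont.preimage_isClosed_of_isClosed isClosed_Icc (isClosed_Iic (a := c))
    exact this
  have hSc : IsCompact S := isCompact_Icc.of_isClosed_subset hScl fun r hr => hr.1
  have hmem := hSc.sSup_mem ⟨t₁, ⟨le_rfl, ht⟩, hut₁⟩
  have h1 := key (sSup S) t (ht₁.trans hmem.1.1) hmem.1.2 fun r hr => by
    by_contra! hle
    exact absurd (le_csSup hSc.bddAbove ⟨⟨hmem.1.1.trans hr.1.le, hr.2⟩, hle⟩) (not_le.2 hr.1)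
  have h2 := hmem.2
  have h3 := mul_nonneg hκ.le (sub_nonneg.2 hmem.1.2)
  linarith

/-! ### Global solutions of Lipschitz equations -/

section Lipschitz

variable {V : Type*} [Fintype V]

/-- Coordinatewise truncation at height `R`, that is, the projection onto the sup-norm ball of
radius `R`. -/
def truncate (R : ℝ) (x : V → ℝ) : V → ℝ := fun i => max (-R) (min (x i) R)

lemma lipschitzWith_truncate (R : ℝ) : LipschitzWith 1 (truncate R : (V → ℝ) → V → ℝ) := by
  refine LipschitzWith.of_dist_le_mul fun x y => ?_
  rw [NNReal.coe_one, one_mul]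
  refine (dist_pi_le_iff dist_nonneg).2 fun i => ?_
  have h := ((LipschitzWith.id (α := ℝ)).min_const R).const_max (-R)
  have := h.dist_le_mul (x i) (y i)
  rw [NNReal.coe_one, one_mul] at this
  exact this.trans (dist_le_pi_dist x y i)

lemma norm_truncate_le {R : ℝ} (hR : 0 ≤ R) (x : V → ℝ) : ‖truncate R x‖ ≤ R := by
  refine (pi_norm_le_iff_of_nonneg hR).2 fun i => ?_
  rw [Real.norm_eq_abs, abs_le]
  exact ⟨le_max_left _ _, max_le (by linarith) (min_le_right _ _)⟩

lemma norm_truncate_le_norm {R : ℝ} (hR : 0 ≤ R) (x : V → ℝ) : ‖truncate R x‖ ≤ ‖x‖ := by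
  have h := (lipschitzWith_truncate (V := V) R).dist_le_mul x 0
  have h0 : truncate R (0 : V → ℝ) = 0 := by
    ext i
    simp [truncate, hR]
  simpa [h0] using h

lemma truncate_of_norm_le {R : ℝ} {x : V → ℝ} (hx : ‖x‖ ≤ R) : truncate R x = x := by
  ext i
  have h := abs_le.1 ((norm_le_pi_norm x i).trans hx)
  rw [truncate, min_eq_left h.2, max_eq_right h.1]

/-- A Lipschitz vector field of linear growth has solutions on `[0, T]`, for every `T`: the
truncated field is bounded, so that the Picard–Lindelöf theorem applies to all of `[0, T]`, and
Grönwall's inequality shows that the solution never reaches the level of truncation. -/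
lemma exists_solution_Icc {f : (V → ℝ) → V → ℝ} {K : ℝ≥0} (hf : LipschitzWith K f) {C D : ℝ}
    (hC : 0 ≤ C) (hD : 0 ≤ D) (hgrowth : ∀ x, ‖f x‖ ≤ C * ‖x‖ + D) (x₀ : V → ℝ) {T : ℝ}
    (hT : 0 ≤ T) :
    ∃ x : ℝ → V → ℝ, x 0 = x₀ ∧
      ∀ t ∈ Icc 0 T, HasDerivWithinAt x (f (x t)) (Icc 0 T) t ∧
        ‖x t‖ ≤ gronwallBound ‖x₀‖ C D t := by
  set R := gronwallBound ‖x₀‖ C D T with hR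
  have hmono := gronwallBound_mono (norm_nonneg x₀) hD hC
  have hR0 : 0 ≤ R := by
    have := hmono hT
    rw [gronwallBound_x0] at this
    exact (norm_nonneg _).trans this
  set M : ℝ≥0 := (C * R + D).toNNReal with hM
  have hM' : (M : ℝ) = C * R + D := Real.coe_toNNReal _ (by positivity)
  have hpl : IsPicardLindelof (fun _ => f ∘ truncate R) (tmin := 0) (tmax := T) ⟨0, le_rfl, hT⟩ x₀
      (M * T.toNNReal) 0 M (K * 1) := by
    refine IsPicardLindelof.of_time_independent (fun x _ => ?_)
      (hf.comp (lipschitzWith_truncate R)).lipschitzOnWith ?_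
    · rw [hM']
      refine (hgrowth _).trans ?_
      gcongr
      exact norm_truncate_le hR0 x
    · simp [hT]
  obtain ⟨x, hx0, hx⟩ := hpl.exists_eq_forall_mem_Icc_hasDerivWithinAt₀
  have hcont : ContinuousOn x (Icc 0 T) := fun t ht => (hx t ht).continuousWithinAt
  have hbound : ∀ t ∈ Icc 0 T, ‖x t‖ ≤ gronwallBound ‖x₀‖ C D t := by
    intro t ht
    have := norm_le_gronwallBound_of_norm_deriv_right_le (f := x)
      (f' := fun t => f (truncate R (x t))) (δ := ‖x₀‖) (K := C) (ε := D) hcont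
      (fun r hr => (hx r ⟨hr.1, hr.2.le⟩).mono_of_mem_nhdsWithin
        (Icc_mem_nhdsGE_of_mem hr)) (by rw [hx0])
      (fun r _ => (hgrowth _).trans (by gcongr; exact norm_truncate_le_norm hR0 _)) t ht
    simpa using this
  refine ⟨x, hx0, fun t ht => ⟨?_, hbound t ht⟩⟩
  have h := hx t ht
  rwa [Function.comp_apply, truncate_of_norm_le ((hbound t ht).trans (hmono ht.2))] at h

end Lipschitz

/-! ### Derivatives of limits of approximate solutions -/

/-- If curves `x n` with `ẋ n = f n (x n)` converge to `X` locally uniformly near `t`, then a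
functional that is bounded above on the fields `f n` near `X t`, for large `n`, by a continuous
function `g` is bounded by `g (X t)` on the derivative of `X` at `t`. -/
lemma apply_le_of_hasDerivAt_of_tendsto {E : Type*} [NormedAddCommGroup E] [NormedSpace ℝ E]
    {x : ℕ → ℝ → E} {X : ℝ → E} {f : ℕ → E → E} {t : ℝ} {v : E} (hX : HasDerivAt X v t)
    (hlim : Tendsto (fun p : ℕ × ℝ => x p.1 p.2) (atTop ×ˢ 𝓝 t) (𝓝 (X t)))
    (hpt : ∀ᶠ r in 𝓝 t, Tendsto (fun n => x n r) atTop (𝓝 (X r)))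
    (hd : ∀ᶠ p : ℕ × ℝ in atTop ×ˢ 𝓝 t, HasDerivAt (x p.1) (f p.1 (x p.1 p.2)) p.2)
    (l : E →L[ℝ] ℝ) {g : E → ℝ} (hg : ContinuousAt g (X t))
    (hfg : ∀ᶠ p : ℕ × E in atTop ×ˢ 𝓝 (X t), l (f p.1 p.2) ≤ g p.2) : l v ≤ g (X t) := by
  refine le_of_forall_pos_le_add fun η hη => ?_
  set c := g (X t) + η
  have hev : ∀ᶠ p : ℕ × ℝ in atTop ×ˢ 𝓝 t, ∃ w, l w ≤ c ∧ HasDerivAt (x p.1) w p.2 := by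
    have h1 := (tendsto_fst.prodMk hlim).eventually hfg
    have h2 := hlim.eventually (hg.eventually_lt_const (lt_add_of_pos_right _ hη))
    filter_upwards [hd, h1, h2] with p hp1 hp2 hp3
    exact ⟨_, hp2.trans hp3.le, hp1⟩
  rw [eventually_prod_iff] at hev
  obtain ⟨pa, hpa, pb, hpb, hp⟩ := hev
  obtain ⟨δ, hδ, hball⟩ := Metric.eventually_nhds_iff_ball.1 (hpb.and hpt)
  have hslope : ∀ r ∈ Ioo t (t + δ), l (X r) - l (X t) ≤ c * (r - t) := by
    intro r hr
    have hball' : ∀ q ∈ Icc t r, pb q ∧ Tendsto (fun n => x n q) atTop (𝓝 (X q)) := by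
      intro q hq
      refine hball q ?_
      rw [Metric.mem_ball, Real.dist_eq, abs_of_nonneg (by linarith [hq.1])]
      linarith [hq.2, hr.2]
    have hrt : t ≤ r := hr.1.le
    have hl := fun q hq => (l.continuous.tendsto _).comp (hball' q hq).2
    refine le_of_tendsto ((hl r ⟨hrt, le_rfl⟩).sub (hl t ⟨le_rfl, hrt⟩)) ?_
    filter_upwards [hpa] with n hn
    have hder : ∀ q ∈ Icc t r, ∃ w ≤ c, HasDerivAt (fun q => l (x n q)) w q := by
      intro q hq
      obtain ⟨w, hw, hxw⟩ := hp hn (hball' q hq).1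
      exact ⟨l w, hw, l.hasFDerivAt.comp_hasDerivAt q hxw⟩
    refine (convex_Icc t r).image_sub_le_mul_sub_of_deriv_le (f := fun q => l (x n q)) ?_ ?_ ?_
      t ⟨le_rfl, hrt⟩ r ⟨hrt, le_rfl⟩ hrt
    · intro q hq
      obtain ⟨w, -, hw⟩ := hder q hq
      exact hw.continuousAt.continuousWithinAt
    · intro q hq
      obtain ⟨w, -, hw⟩ := hder q (interior_subset hq)
      exact hw.differentiableAt.differentiableWithinAt
    · intro q hq
      obtain ⟨w, hwc, hw⟩ := hder q (interior_subset hq)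
      rwa [hw.deriv]
  have hlX : HasDerivAt (fun r => l (X r)) (l v) t := l.hasFDerivAt.comp_hasDerivAt t hX
  have htend : Tendsto (slope (fun r => l (X r)) t) (𝓝[>] t) (𝓝 (l v)) :=
    (hasDerivAt_iff_tendsto_slope.1 hlX).mono_left
      (nhdsWithin_mono t fun r (hr : t < r) => ne_of_gt hr)
  refine le_of_tendsto htend ?_
  filter_upwards [Ioo_mem_nhdsGT (lt_add_of_pos_right t hδ)] with r hr
  rw [slope_def_field, div_le_iff₀ (sub_pos.2 hr.1)]
  exact hslope r hr

/-! ### Dissipativity and uniqueness -/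

lemma hasDerivAt_sum_sub_sq {V : Type*} [Fintype V] {x y : ℝ → V → ℝ} {v w : V → ℝ} {t : ℝ} (hx : HasDerivAt x v t)
    (hy : HasDerivAt y w t) :
    HasDerivAt (fun t => ∑ i, (x t i - y t i) ^ 2) (2 * ∑ i, (x t i - y t i) * (v i - w i)) t := by
  rw [Finset.mul_sum]
  refine HasDerivAt.fun_sum fun i _ => ?_
  have h := ((hasDerivAt_pi.1 hx i).fun_sub (hasDerivAt_pi.1 hy i)).fun_pow 2
  refine h.congr_deriv ?_
  push_cast
  ring

lemma isFilippovSolutionOn_mono {V : Type*} [Fintype V] {f : (V → ℝ) → V → ℝ} {x : ℝ → V → ℝ} {I J : Set ℝ}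
    (hx : IsFilippovSolutionOn f x I) (hJ : J ⊆ I) : IsFilippovSolutionOn f x J :=
  ⟨fun a ha b hb => hx.absolutelyContinuous a (hJ ha) b (hJ hb),
    ae_restrict_of_ae_restrict_of_subset hJ hx.deriv_mem⟩

section Existence

variable {V : Type*} [Fintype V] [DecidableEq V] {G : SimpleGraph V} [DecidableRel G.Adj]
  {s z : V → ℝ} {γ : ℝ}

/-- The fields `s p + A x` and `s q + A y`, with `A` the consensus term, are dissipative up to the
error made by the signs `p` and `q`. -/
lemma sum_sub_mul_sub_le (hs : ∀ i, s i = 0 ∨ s i = 1) (hγ : 0 < γ) {x y v w p q : V → ℝ} {ε : ℝ}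
    (hε : 0 ≤ ε) (hv : ∀ i, v i = s i * p i + consensus G γ x i)
    (hw : ∀ i, w i = s i * q i + consensus G γ y i)
    (hpq : ∀ i, (x i - y i) * (p i - q i) ≤ ε) :
    ∑ i, (x i - y i) * (v i - w i) ≤ Fintype.card V * ε := by
  have h := sum_mul_consensus_nonpos G hγ (x - y)
  have h2 : ∑ i, s i * ((x i - y i) * (p i - q i)) ≤ Fintype.card V * ε := by
    have : ∑ i : V, ε = Fintype.card V * ε := by simp
    rw [← this]
    refine Finset.sum_le_sum fun i _ => ?_
    rcases hs i with h | h <;> rw [h]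
    · simpa using hε
    · simpa using hpq i
  have h3 : ∑ i, (x i - y i) * (v i - w i) =
      ∑ i, s i * ((x i - y i) * (p i - q i)) + ∑ i, (x - y) i * consensus G γ (x - y) i := by
    rw [← Finset.sum_add_distrib]
    refine Finset.sum_congr rfl fun i _ => ?_
    rw [hv, hw, map_sub]
    simp only [Pi.sub_apply]
    ring
  linarith

lemma ae_deriv_mem_solverSet (hs : ∀ i, s i = 0 ∨ s i = 1) {x : ℝ → V → ℝ} {I : Set ℝ}
    (hI : MeasurableSet I) (hx : IsFilippovSolutionOn (medianSolver G s z γ) x I) :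
    ∀ᵐ t, t ∈ I → ∃ v ∈ solverSet G s z γ (x t), HasDerivAt x v t := by
  filter_upwards [(ae_restrict_iff' hI).1 hx.deriv_mem] with t ht hmem
  obtain ⟨v, hv, hd⟩ := ht hmem
  exact ⟨v, (filippovMap_medianSolver hs _).subset hv, hd⟩

/-- Solutions of the solver are determined by their initial value. -/
theorem eqOn_of_isFilippovSolutionOn (hs : ∀ i, s i = 0 ∨ s i = 1) (hγ : 0 < γ) {x y : ℝ → V → ℝ}
    {I : Set ℝ} (hI : MeasurableSet I) (hI0 : ∀ b ∈ I, 0 ≤ b ∧ Icc 0 b ⊆ I)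
    (hx : IsFilippovSolutionOn (medianSolver G s z γ) x I)
    (hy : IsFilippovSolutionOn (medianSolver G s z γ) y I) (h0 : x 0 = y 0) : EqOn x y I := by
  intro b hb
  obtain ⟨hb0, hsub⟩ := hI0 b hb
  have h0I : (0 : ℝ) ∈ I := hsub ⟨le_rfl, hb0⟩
  have hac : AbsolutelyContinuousOnInterval (fun t => ∑ i, (x t i - y t i) ^ 2) 0 b := by
    simp only [sq]
    refine absolutelyContinuousOnInterval_sum _ fun i => ?_
    have h := (absolutelyContinuousOnInterval_eval (hx.absolutelyContinuous 0 h0I b hb) i).fun_sub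
      (absolutelyContinuousOnInterval_eval (hy.absolutelyContinuous 0 h0I b hb) i)
    exact h.fun_mul h
  have hle := sub_le_of_ae_deriv_le (c := 0) hb0 hac (by
    filter_upwards [ae_deriv_mem_solverSet hs hI hx, ae_deriv_mem_solverSet hs hI hy]
      with t h1 h2 ht
    have htI := hsub ⟨ht.1.le, ht.2⟩
    obtain ⟨v, ⟨p, hp, hv⟩, hxd⟩ := h1 htI
    obtain ⟨w, ⟨q, hq, hw⟩, hyd⟩ := h2 htI
    refine ⟨_, ?_, hasDerivAt_sum_sub_sq hxd hyd⟩
    have := sum_sub_mul_sub_le hs hγ le_rfl hv hw fun i => by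
      have := signSet_monotone (hp i) (hq i)
      linarith
    linarith)
  rw [h0] at hle
  have hzero : ∑ i, (x b i - y b i) ^ 2 = 0 :=
    le_antisymm (by simpa using hle) (Finset.sum_nonneg fun i _ => sq_nonneg _)
  ext i
  have := (Finset.sum_eq_zero_iff_of_nonneg fun i _ => sq_nonneg _).1 hzero i (Finset.mem_univ i)
  exact sub_eq_zero.1 (pow_eq_zero_iff two_ne_zero |>.1 this)

/-! ### Saturated approximations -/

/-- The saturation function, which truncates its argument to `[-1, 1]`. -/
def sat (u : ℝ) : ℝ := max (-1) (min u 1)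

lemma abs_sat_le (u : ℝ) : |sat u| ≤ 1 :=
  abs_le.2 ⟨le_max_left _ _, max_le (by norm_num) (min_le_right _ _)⟩

lemma sat_of_one_le {u : ℝ} (h : 1 ≤ u) : sat u = 1 := by
  rw [sat, min_eq_right h]; norm_num

lemma sat_of_le_neg_one {u : ℝ} (h : u ≤ -1) : sat u = -1 := by
  rw [sat, min_eq_left (by linarith), max_eq_left h]

lemma lipschitzWith_sat : LipschitzWith 1 sat :=
  (LipschitzWith.id.min_const 1).const_max (-1)

/-- The saturation `sat (κ a)` is the Yosida approximation of the set-valued sign: it is an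
admissible sign at the nearby point `a - sat (κ a) / κ`. -/
lemma sat_mem_signSet {κ : ℝ} (hκ : 0 < κ) (a : ℝ) :
    sat (κ * a) ∈ signSet (a - sat (κ * a) / κ) := by
  have h : a - sat (κ * a) / κ = (κ * a - sat (κ * a)) / κ := by field_simp
  rw [h]
  refine ⟨abs_sat_le _, fun h => ?_, fun h => ?_⟩
  · rw [div_pos_iff_of_pos_right hκ, sub_pos] at h
    refine sat_of_one_le ?_
    by_contra! h1
    rw [sat, min_eq_left h1.le] at h
    exact absurd (le_max_right (-1) (κ * a)) (not_le.2 h)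
  · rw [div_lt_iff₀ hκ, zero_mul, sub_neg] at h
    refine sat_of_le_neg_one ?_
    by_contra! h1
    rw [sat, lt_max_iff, lt_min_iff] at h
    rcases h with h | h
    · linarith
    · exact lt_irrefl _ h.1

lemma sat_almost_monotone {κ μ : ℝ} (hκ : 0 < κ) (hμ : 0 < μ) (a b : ℝ) :
    (b - a) * (sat (κ * a) - sat (μ * b)) ≤ 2 * (1 / κ + 1 / μ) := by
  have h := signSet_monotone (sat_mem_signSet hκ a) (sat_mem_signSet hμ b)
  set p := sat (κ * a) with hp
  set q := sat (μ * b) with hq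
  have hp1 : |p| ≤ 1 := abs_sat_le _
  have hq1 : |q| ≤ 1 := abs_sat_le _
  have h1 : |q / μ - p / κ| ≤ 1 / κ + 1 / μ := by
    refine (abs_sub _ _).trans ?_
    rw [abs_div, abs_div, abs_of_pos hκ, abs_of_pos hμ, add_comm]
    gcongr
  have h2 : |p - q| ≤ 2 := (abs_sub _ _).trans (by linarith)
  have h3 : (q / μ - p / κ) * (p - q) ≤ (1 / κ + 1 / μ) * 2 := by
    refine (le_abs_self _).trans ?_
    rw [abs_mul]
    exact mul_le_mul h1 h2 (abs_nonneg _) (by positivity)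
  nlinarith

/-- The solver with `sgn u` replaced by `sat (κ u)`. -/
noncomputable def saturatedSolver (G : SimpleGraph V) [DecidableRel G.Adj] (s z : V → ℝ) (γ κ : ℝ)
    (x : V → ℝ) : V → ℝ :=
  (fun i => s i * sat (κ * (z i - x i))) + consensus G γ x

lemma saturatedSolver_apply (κ : ℝ) (x : V → ℝ) (i : V) :
    saturatedSolver G s z γ κ x i = s i * sat (κ * (z i - x i)) + consensus G γ x i := rfl

lemma lipschitzWith_saturatedSolver (hs : ∀ i, s i = 0 ∨ s i = 1) (κ : ℝ≥0) :
    LipschitzWith (κ + ‖consensus G γ‖₊) (saturatedSolver G s z γ κ) := by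
  refine LipschitzWith.add (LipschitzWith.of_dist_le_mul fun x y => ?_)
    (consensus G γ).lipschitz
  refine (dist_pi_le_iff (by positivity)).2 fun i => ?_
  have h1 : dist (sat (κ * (z i - x i))) (sat (κ * (z i - y i))) ≤ κ * dist x y := by
    refine (lipschitzWith_sat.dist_le_mul _ _).trans ?_
    have h : dist (κ * (z i - x i)) (κ * (z i - y i)) = κ * dist (x i) (y i) := by
      rw [Real.dist_eq, Real.dist_eq, ← mul_sub, abs_mul, NNReal.abs_eq, abs_sub_comm (x i)]
      ring_nf
    rw [h, NNReal.coe_one, one_mul]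
    gcongr
    exact dist_le_pi_dist x y i
  rcases hs i with h | h <;> simp only [h]
  · simpa using by positivity
  · simpa using h1

lemma norm_saturatedSolver_le (hs : ∀ i, s i = 0 ∨ s i = 1) (κ : ℝ) (x : V → ℝ) :
    ‖saturatedSolver G s z γ κ x‖ ≤ ‖consensus G γ‖ * ‖x‖ + 1 := by
  rw [add_comm]
  refine (norm_add_le _ _).trans (add_le_add ?_ ((consensus G γ).le_opNorm x))
  refine (pi_norm_le_iff_of_nonneg zero_le_one).2 fun i => ?_
  rcases hs i with h | h <;> simp [h, abs_sat_le]

/-- Two saturated solutions with the same initial value stay close to each other. -/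
lemma sum_sub_sq_le_of_saturatedSolver (hs : ∀ i, s i = 0 ∨ s i = 1) (hγ : 0 < γ)
    {κ μ : ℝ} (hκ : 0 < κ) (hμ : 0 < μ) {x y : ℝ → V → ℝ} {T : ℝ} (hT : 0 ≤ T) (h0 : x 0 = y 0)
    (hx : ∀ t ∈ Icc 0 T, HasDerivWithinAt x (saturatedSolver G s z γ κ (x t)) (Icc 0 T) t)
    (hy : ∀ t ∈ Icc 0 T, HasDerivWithinAt y (saturatedSolver G s z γ μ (y t)) (Icc 0 T) t) :
    ∑ i, (x T i - y T i) ^ 2 ≤ 4 * Fintype.card V * (1 / κ + 1 / μ) * T := by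
  have hxc : ContinuousOn x (Icc 0 T) := fun t ht => (hx t ht).continuousWithinAt
  have hyc : ContinuousOn y (Icc 0 T) := fun t ht => (hy t ht).continuousWithinAt
  have hder : ∀ t ∈ Ioo 0 T, ∃ d ≤ 4 * Fintype.card V * (1 / κ + 1 / μ),
      HasDerivAt (fun t => ∑ i, (x t i - y t i) ^ 2) d t := by
    intro t ht
    have hn := Icc_mem_nhds ht.1 ht.2
    refine ⟨_, ?_, hasDerivAt_sum_sub_sq ((hx t (Ioo_subset_Icc_self ht)).hasDerivAt hn)
      ((hy t (Ioo_subset_Icc_self ht)).hasDerivAt hn)⟩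
    have := sum_sub_mul_sub_le hs hγ (ε := 2 * (1 / κ + 1 / μ)) (by positivity)
      (saturatedSolver_apply (G := G) (z := z) κ (x t))
      (saturatedSolver_apply (G := G) (z := z) μ (y t)) (fun i => by
        have := sat_almost_monotone hκ hμ (z i - x t i) (z i - y t i)
        rwa [sub_sub_sub_cancel_left] at this)
    linarith
  have h := (convex_Icc 0 T).image_sub_le_mul_sub_of_deriv_le
    (f := fun t => ∑ i, (x t i - y t i) ^ 2)
    (C := 4 * Fintype.card V * (1 / κ + 1 / μ)) ?_ ?_ ?_ 0 ⟨le_rfl, hT⟩ T ⟨hT, le_rfl⟩ hT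
  · simpa [h0] using h
  · refine continuousOn_finsetSum _ fun i _ => ?_
    exact ((continuousOn_pi.1 hxc i).sub (continuousOn_pi.1 hyc i)).pow 2
  · intro t ht
    rw [interior_Icc] at ht
    obtain ⟨d, -, hd⟩ := hder t ht
    exact hd.differentiableAt.differentiableWithinAt
  · intro t ht
    rw [interior_Icc] at ht
    obtain ⟨d, hdc, hd⟩ := hder t ht
    rwa [hd.deriv]

/-! ### Existence -/

/-- The saturated solutions, the `n`-th one on `[0, n]` with slope `n + 1`, converge locally
uniformly. -/
lemma exists_limit_saturatedSolver (hs : ∀ i, s i = 0 ∨ s i = 1) (hγ : 0 < γ) (x₀ : V → ℝ) :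
    ∃ (x : ℕ → ℝ → V → ℝ) (X : ℝ → V → ℝ), X 0 = x₀ ∧
      (∀ n : ℕ, ∀ t ∈ Icc (0 : ℝ) n,
        HasDerivWithinAt (x n) (saturatedSolver G s z γ (n + 1) (x n t)) (Icc (0 : ℝ) n) t) ∧
      (∀ T : ℝ, TendstoUniformlyOn x X atTop (Icc 0 T)) ∧
      ∀ T : ℝ, ∃ M, LipschitzOnWith M X (Icc 0 T) := by
  have hex : ∀ n : ℕ, ∃ x : ℝ → V → ℝ, x 0 = x₀ ∧ ∀ t ∈ Icc (0 : ℝ) n,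
      HasDerivWithinAt x (saturatedSolver G s z γ (n + 1) (x t)) (Icc (0 : ℝ) n) t ∧
        ‖x t‖ ≤ gronwallBound ‖x₀‖ ‖consensus G γ‖ 1 t := by
    intro n
    have hl := lipschitzWith_saturatedSolver (G := G) (z := z) (γ := γ) hs (n + 1)
    push_cast at hl
    exact exists_solution_Icc hl (norm_nonneg _) zero_le_one (norm_saturatedSolver_le hs _) x₀
      n.cast_nonneg
  choose x hx0 hx using hex
  have hcauchy : ∀ T : ℝ, UniformCauchySeqOn x atTop (Icc 0 T) := by
    intro T
    rw [Metric.uniformCauchySeqOn_iff]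
    intro ε hε
    -- the squared distance is at most `8 |V| T / (N + 1)` beyond `N`
    obtain ⟨N, hN⟩ := exists_nat_gt (max T (8 * Fintype.card V * T / ε ^ 2))
    have hNT : T ≤ N := (le_max_left _ _).trans hN.le
    have hN2 : 8 * Fintype.card V * T < ε ^ 2 * (N + 1) := by
      have := (le_max_right _ _).trans_lt hN
      rw [div_lt_iff₀ (by positivity)] at this
      nlinarith [sq_nonneg ε]
    refine ⟨N, fun m hm n hn t ht => (dist_pi_lt_iff hε).2 fun i => ?_⟩
    have hm' : (N : ℝ) ≤ m := by exact_mod_cast hm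
    have hn' : (N : ℝ) ≤ n := by exact_mod_cast hn
    have hsub : ∀ k : ℕ, (N : ℝ) ≤ k → Icc 0 t ⊆ Icc (0 : ℝ) k := fun k hk =>
      Icc_subset_Icc_right (ht.2.trans (hNT.trans hk))
    have h := sum_sub_sq_le_of_saturatedSolver hs hγ (κ := m + 1) (μ := n + 1)
      (by positivity) (by positivity) ht.1 ((hx0 m).trans (hx0 n).symm)
      (fun r hr => ((hx m r (hsub m hm' hr)).1).mono (hsub m hm'))
      (fun r hr => ((hx n r (hsub n hn' hr)).1).mono (hsub n hn'))
    have h1 : (x m t i - x n t i) ^ 2 ≤ ∑ i, (x m t i - x n t i) ^ 2 :=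
      Finset.single_le_sum (f := fun i => (x m t i - x n t i) ^ 2)
        (fun i _ => sq_nonneg _) (Finset.mem_univ i)
    have h2 : 4 * Fintype.card V * (1 / ((m : ℝ) + 1) + 1 / ((n : ℝ) + 1)) * t ≤
        4 * Fintype.card V * (1 / ((N : ℝ) + 1) + 1 / ((N : ℝ) + 1)) * T := by
      have := ht.1
      have := ht.2
      gcongr
    have h3 : 4 * Fintype.card V * (1 / ((N : ℝ) + 1) + 1 / ((N : ℝ) + 1)) * T < ε ^ 2 := by
      have : 4 * Fintype.card V * (1 / ((N : ℝ) + 1) + 1 / ((N : ℝ) + 1)) * T =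
          8 * Fintype.card V * T / (N + 1) := by field_simp; ring
      rw [this, div_lt_iff₀ (by positivity)]
      exact hN2
    rw [Real.dist_eq]
    exact abs_lt_of_sq_lt_sq (by linarith) hε.le
  have hlim : ∀ t : ℝ, ∃ l, 0 ≤ t → Tendsto (fun n => x n t) atTop (𝓝 l) := by
    intro t
    by_cases ht : 0 ≤ t
    · obtain ⟨l, hl⟩ := cauchySeq_tendsto_of_complete ((hcauchy t).cauchySeq ⟨ht, le_rfl⟩)
      exact ⟨l, fun _ => hl⟩
    · exact ⟨0, fun h => absurd h ht⟩
  choose X hX using hlim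
  refine ⟨x, X, ?_, fun n t ht => (hx n t ht).1,
    fun T => (hcauchy T).tendstoUniformlyOn_of_tendsto fun t ht => hX t ht.1, fun T => ?_⟩
  · exact tendsto_nhds_unique (hX 0 le_rfl) (by simp [hx0])
  · rcases lt_or_ge T 0 with hT | hT
    · exact ⟨0, by simp [Icc_eq_empty (not_le.2 hT)]⟩
    set B := gronwallBound ‖x₀‖ ‖consensus G γ‖ 1 T with hB
    have hmono := gronwallBound_mono (norm_nonneg x₀) zero_le_one (norm_nonneg (consensus G γ))
    have hB0 : 0 ≤ B := by
      have := hmono hT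
      rw [gronwallBound_x0] at this
      exact (norm_nonneg _).trans this
    set M : ℝ≥0 := (‖consensus G γ‖ * B + 1).toNNReal with hM
    have hM' : (M : ℝ) = ‖consensus G γ‖ * B + 1 := Real.coe_toNNReal _ (by positivity)
    have hlip : ∀ n : ℕ, T ≤ n → LipschitzOnWith M (x n) (Icc 0 T) := by
      intro n hn
      have hsub : Icc 0 T ⊆ Icc (0 : ℝ) n := Icc_subset_Icc_right hn
      refine (convex_Icc 0 T).lipschitzOnWith_of_nnnorm_hasDerivWithin_le
        (fun t ht => ((hx n t (hsub ht)).1).mono hsub) fun t ht => ?_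
      rw [← NNReal.coe_le_coe, coe_nnnorm, hM']
      refine (norm_saturatedSolver_le hs _ _).trans ?_
      gcongr
      exact (hx n t (hsub ht)).2.trans (hmono ht.2)
    refine ⟨M, LipschitzOnWith.of_dist_le_mul fun a ha b hb => ?_⟩
    refine le_of_tendsto ((hX a ha.1).dist (hX b hb.1)) ?_
    obtain ⟨N, hN⟩ := exists_nat_ge T
    filter_upwards [eventually_ge_atTop N] with n hn
    exact (hlip n (hN.trans (by exact_mod_cast hn))).dist_le_mul a ha b hb

/-- The derivative of a limit of saturated solutions lies in the Filippov set. -/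
lemma mem_solverSet_of_limit (hs : ∀ i, s i = 0 ∨ s i = 1) {x : ℕ → ℝ → V → ℝ} {X : ℝ → V → ℝ}
    {t : ℝ} {v : V → ℝ} (hX : HasDerivAt X v t)
    (hlim : Tendsto (fun p : ℕ × ℝ => x p.1 p.2) (atTop ×ˢ 𝓝 t) (𝓝 (X t)))
    (hpt : ∀ᶠ r in 𝓝 t, Tendsto (fun n => x n r) atTop (𝓝 (X r)))
    (hd : ∀ᶠ p : ℕ × ℝ in atTop ×ˢ 𝓝 t,
      HasDerivAt (x p.1) (saturatedSolver G s z γ (p.1 + 1) (x p.1 p.2)) p.2) :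
    v ∈ solverSet G s z γ (X t) := by
  have hs0 : ∀ i, 0 ≤ s i := fun i => by rcases hs i with h | h <;> simp [h]
  have key := fun (l : (V → ℝ) →L[ℝ] ℝ) (g : (V → ℝ) → ℝ) (hg : ContinuousAt g (X t)) hfg =>
    apply_le_of_hasDerivAt_of_tendsto (f := fun n => saturatedSolver G s z γ (n + 1))
      hX hlim hpt hd l hg hfg
  have hbig : ∀ c : ℝ, ∀ᶠ n : ℕ in atTop, c ≤ (n : ℝ) + 1 := by
    intro c
    filter_upwards [tendsto_natCast_atTop_atTop.eventually_ge_atTop c] with n hn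
    exact hn.trans (by linarith)
  refine mem_solverSet_of_le hs (fun i => ?_) (fun i => ?_) (fun i hi => ?_) (fun i hi => ?_)
  · refine key (ContinuousLinearMap.proj i) (fun y => s i + consensus G γ y i) (by fun_prop)
      (Eventually.of_forall fun p => ?_)
    simp only [ContinuousLinearMap.proj_apply, saturatedSolver_apply]
    have := (abs_le.1 (abs_sat_le ((p.1 + 1) * (z i - p.2 i)))).2
    nlinarith [hs0 i]
  · refine key (-ContinuousLinearMap.proj i) (fun y => s i - consensus G γ y i) (by fun_prop)
      (Eventually.of_forall fun p => ?_)
    simp only [_root_.neg_apply, ContinuousLinearMap.proj_apply, saturatedSolver_apply]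
    have := (abs_le.1 (abs_sat_le ((p.1 + 1) * (z i - p.2 i)))).1
    nlinarith [hs0 i]
  -- away from `z i` the saturation is exact as soon as the slope is large enough
  · refine key (ContinuousLinearMap.proj i) (fun y => -s i + consensus G γ y i) (by fun_prop) ?_
    obtain ⟨c, hc1, hc2⟩ := exists_between hi
    have h1 := ((continuous_apply i).tendsto (X t)).eventually_const_lt hc2
    filter_upwards [(hbig (1 / (c - z i))).prod_mk h1] with p hp
    simp only [ContinuousLinearMap.proj_apply, saturatedSolver_apply]
    have h2 := hp.1
    rw [div_le_iff₀ (sub_pos.2 hc1)] at h2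
    have h3 : c < p.2 i := hp.2
    have h4 : (0 : ℝ) < p.1 + 1 := by positivity
    rw [sat_of_le_neg_one (by nlinarith)]
    linarith
  · refine key (-ContinuousLinearMap.proj i) (fun y => -s i - consensus G γ y i) (by fun_prop) ?_
    obtain ⟨c, hc1, hc2⟩ := exists_between hi
    have h1 := ((continuous_apply i).tendsto (X t)).eventually_lt_const hc1
    filter_upwards [(hbig (1 / (z i - c))).prod_mk h1] with p hp
    simp only [_root_.neg_apply, ContinuousLinearMap.proj_apply, saturatedSolver_apply]
    have h2 := hp.1
    rw [div_le_iff₀ (sub_pos.2 hc2)] at h2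
    have h3 : p.2 i < c := hp.2
    have h4 : (0 : ℝ) < p.1 + 1 := by positivity
    rw [sat_of_one_le (by nlinarith)]
    linarith

theorem exists_isFilippovSolutionOn (hs : ∀ i, s i = 0 ∨ s i = 1) (hγ : 0 < γ) (x₀ : V → ℝ) :
    ∃ x : ℝ → V → ℝ, IsFilippovSolutionOn (medianSolver G s z γ) x (Ici 0) ∧ x 0 = x₀ := by
  obtain ⟨x, X, hX0, hx, hunif, hlip⟩ :=
    exists_limit_saturatedSolver (G := G) (z := z) hs hγ x₀
  refine ⟨X, ⟨fun a ha b hb => ?_, ?_⟩, hX0⟩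
  · obtain ⟨M, hM⟩ := hlip (max a b)
    refine (hM.mono fun t ht => ?_).absolutelyContinuousOnInterval
    exact ⟨(le_min ha hb).trans ht.1, ht.2⟩
  rw [ae_restrict_iff' measurableSet_Ici]
  have hdiff : ∀ᵐ t, ∀ n : ℕ, t ∈ Icc (0 : ℝ) n → DifferentiableWithinAt ℝ X (Icc (0 : ℝ) n) t := by
    rw [ae_all_iff]
    intro n
    obtain ⟨M, hM⟩ := hlip n
    exact hM.ae_differentiableWithinAt_of_mem_real
  filter_upwards [hdiff, compl_mem_ae_iff.2 (measure_singleton (0 : ℝ))] with t ht ht0 htnn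
  have htpos : 0 < t := lt_of_le_of_ne htnn fun h => ht0 h.symm
  obtain ⟨N, hN⟩ := exists_nat_gt t
  have hnhds : Icc (0 : ℝ) N ∈ 𝓝 t := Icc_mem_nhds htpos hN
  have hXd := ((ht N ⟨htnn, hN.le⟩).differentiableAt hnhds).hasDerivAt
  refine ⟨_, (filippovMap_medianSolver hs _).superset
    (mem_solverSet_of_limit (x := x) hs hXd ?_ ?_ ?_), hXd⟩
  · rw [Metric.tendsto_nhds]
    intro ε hε
    have h1 := Metric.tendstoUniformlyOn_iff.1 (hunif N) (ε / 2) (half_pos hε)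
    have h2 := Metric.tendsto_nhds.1 hXd.continuousAt (ε / 2) (half_pos hε)
    filter_upwards [h1.prod_mk (h2.and hnhds)] with p hp
    have h3 := hp.1 p.2 hp.2.2
    rw [dist_comm] at h3
    calc dist (x p.1 p.2) (X t) ≤ dist (x p.1 p.2) (X p.2) + dist (X p.2) (X t) :=
          dist_triangle _ _ _
      _ < ε := by linarith [hp.2.1]
  · filter_upwards [hnhds] with r hr
    exact (hunif N).tendsto_at hr
  · have h := (eventually_ge_atTop (N + 1)).prod_mk (Ioo_mem_nhds htpos hN)
    filter_upwards [h] with p hp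
    have hp1 : (N : ℝ) ≤ p.1 := by exact_mod_cast (Nat.le_succ N).trans hp.1
    exact (hx p.1 p.2 ⟨hp.2.1.le, hp.2.2.le.trans hp1⟩).hasDerivAt
      (Icc_mem_nhds hp.2.1 (hp.2.2.trans_le hp1))

/-- By uniqueness, a solution on `[0, T)` is the restriction of the solution on `[0, ∞)` that has
the same initial value. -/
theorem exists_extension (hs : ∀ i, s i = 0 ∨ s i = 1) (hγ : 0 < γ) {T : ℝ} {x : ℝ → V → ℝ}
    (hx : IsFilippovSolutionOn (medianSolver G s z γ) x (Ico 0 T)) :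
    ∃ y : ℝ → V → ℝ, IsFilippovSolutionOn (medianSolver G s z γ) y (Ici 0) ∧
      EqOn y x (Ico 0 T) := by
  obtain ⟨y, hy, hy0⟩ := exists_isFilippovSolutionOn (G := G) (z := z) hs hγ (x 0)
  refine ⟨y, hy, eqOn_of_isFilippovSolutionOn hs hγ measurableSet_Ico (fun b hb => ?_)
    (isFilippovSolutionOn_mono hy Ico_subset_Ici_self) hx hy0⟩
  exact ⟨hb.1, fun t ht => ⟨ht.1, ht.2.trans_lt hb.2⟩⟩

end Existence

/-! ### Medians -/

lemma succ_le_countP_le_getElem {l : List ℝ} (hl : l.Pairwise (· ≤ ·)) {k : ℕ}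
    (hk : k < l.length) : k + 1 ≤ l.countP (· ≤ l[k]) := by
  have h1 : (l.take (k + 1)).countP (· ≤ l[k]) = (l.take (k + 1)).length := by
    refine List.countP_eq_length.2 fun y hy => ?_
    obtain ⟨j, hj, rfl⟩ := List.mem_iff_getElem.1 hy
    rw [List.length_take] at hj
    rw [List.getElem_take, decide_eq_true_iff]
    rcases (show j ≤ k by omega).eq_or_lt with rfl | h
    · exact le_rfl
    · exact List.pairwise_iff_getElem.1 hl j k _ _ h
  have h2 := (l.take_sublist (k + 1)).countP_le (p := (· ≤ l[k]))
  rw [h1, List.length_take] at h2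
  omega

lemma sub_le_countP_getElem_le {l : List ℝ} (hl : l.Pairwise (· ≤ ·)) {k : ℕ}
    (hk : k < l.length) : l.length - k ≤ l.countP (l[k] ≤ ·) := by
  have h1 : (l.drop k).countP (l[k] ≤ ·) = (l.drop k).length := by
    refine List.countP_eq_length.2 fun y hy => ?_
    obtain ⟨j, hj, rfl⟩ := List.mem_iff_getElem.1 hy
    rw [List.getElem_drop, decide_eq_true_iff]
    rcases j.eq_zero_or_pos with rfl | h
    · simp
    · exact List.pairwise_iff_getElem.1 hl k (k + j) _ _ (by omega)
  have h2 := (l.drop_sublist k).countP_le (p := (l[k] ≤ ·))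
  rwa [h1, List.length_drop] at h2

section Median

variable {V : Type*} [Fintype V] (s z : V → ℝ)

lemma coe_sortedIndicated :
    (sortedIndicated s z : Multiset ℝ) = (Finset.univ.filter fun i => s i = 1).val.map z :=
  Multiset.sort_eq _ _

lemma length_sortedIndicated :
    (sortedIndicated s z).length = (Finset.univ.filter fun i => s i = 1).card := by
  rw [← Multiset.coe_card, coe_sortedIndicated, Multiset.card_map]; rfl

lemma countP_sortedIndicated (P : ℝ → Prop) [DecidablePred P] :
    (sortedIndicated s z).countP (fun y => decide (P y)) =
      ((Finset.univ.filter fun i => s i = 1).filter fun i => P (z i)).card := by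
  rw [← Multiset.coe_countP, coe_sortedIndicated, Multiset.countP_map]; rfl

/-- The median set is an interval `[a, b]` such that more than half of the indicated values are at
most `b` and more than half are at least `a`. -/
lemma exists_medianSet_eq_Icc (hs1 : ∃ i, s i = 1) :
    ∃ a b, a ≤ b ∧ medianSet s z = Icc a b ∧
      (Finset.univ.filter fun i => s i = 1).card <
        2 * ((Finset.univ.filter fun i => s i = 1).filter fun i => z i ≤ b).card ∧
      (Finset.univ.filter fun i => s i = 1).card <
        2 * ((Finset.univ.filter fun i => s i = 1).filter fun i => a ≤ z i).card := by
  set l := sortedIndicated s z with hl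
  have hpos : 0 < l.length := by
    obtain ⟨i, hi⟩ := hs1
    rw [hl, length_sortedIndicated]
    exact Finset.card_pos.2 ⟨i, by simp [hi]⟩
  have hsorted : l.Pairwise (· ≤ ·) := Multiset.pairwise_sort _ _
  -- both parities are covered by the positions `(S - 1) / 2` and `S / 2`
  have ha : (l.length - 1) / 2 < l.length := by omega
  have hb : l.length / 2 < l.length := by omega
  have hab : l[(l.length - 1) / 2] ≤ l[l.length / 2] := by
    rcases (show (l.length - 1) / 2 ≤ l.length / 2 by omega).eq_or_lt with h | h
    · simp [h]
    · exact List.pairwise_iff_getElem.1 hsorted _ _ _ _ h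
  refine ⟨l[(l.length - 1) / 2], l[l.length / 2], hab, ?_, ?_, ?_⟩
  · rw [medianSet, ← hl]
    split_ifs with hodd
    · have h1 : (l.length + 1) / 2 - 1 = l.length / 2 := by
        obtain ⟨k, hk⟩ := hodd; omega
      have h2 : (l.length - 1) / 2 = l.length / 2 := by
        obtain ⟨k, hk⟩ := hodd; omega
      simp only [h1, h2, List.getD_eq_getElem _ _ hb, Icc_self]
    · have h1 : l.length / 2 - 1 = (l.length - 1) / 2 := by
        obtain ⟨k, hk⟩ := Nat.not_odd_iff_even.1 hodd; omega
      rw [h1, List.getD_eq_getElem _ _ hb, List.getD_eq_getElem _ _ ha]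
  · have := succ_le_countP_le_getElem hsorted hb
    rw [← countP_sortedIndicated s z (· ≤ l[l.length / 2]), ← length_sortedIndicated s z, ← hl]
    omega
  · have := sub_le_countP_getElem_le hsorted ha
    rw [← countP_sortedIndicated s z (l[(l.length - 1) / 2] ≤ ·), ← length_sortedIndicated s z,
      ← hl]
    omega

variable {s}

/-- A majority of values `-1` among signs makes their sum at most `-1`. -/
lemma sum_mul_le_neg_one (hs : ∀ i, s i = 0 ∨ s i = 1) {P : V → Prop} [DecidablePred P]
    (hP : (Finset.univ.filter fun i => s i = 1).card <
        2 * ((Finset.univ.filter fun i => s i = 1).filter P).card)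
    {p : V → ℝ} (h1 : ∀ i, p i ≤ 1) (h2 : ∀ i, P i → p i ≤ -1) : ∑ i, s i * p i ≤ -1 := by
  set I := Finset.univ.filter fun i => s i = 1 with hI
  have e1 : ∑ i, s i * p i = ∑ i ∈ I, p i := by
    rw [hI, Finset.sum_filter]
    refine Finset.sum_congr rfl fun i _ => ?_
    rcases hs i with h | h <;> simp [h]
  have e2 := Finset.sum_filter_add_sum_filter_not I P p
  have e3 : ∑ i ∈ I with P i, p i ≤ ((I.filter P).card : ℝ) * -1 := by
    rw [← nsmul_eq_mul]
    exact Finset.sum_le_card_nsmul _ _ _ fun i hi => h2 i (Finset.mem_filter.1 hi).2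
  have e4 : ∑ i ∈ I with ¬ P i, p i ≤ ((I.filter fun i => ¬ P i).card : ℝ) * 1 := by
    rw [← nsmul_eq_mul]
    exact Finset.sum_le_card_nsmul _ _ _ fun i _ => h1 i
  have e5 : ((I.filter P).card : ℝ) + (I.filter fun i => ¬ P i).card = I.card := by
    exact_mod_cast Finset.card_filter_add_card_filter_not (s := I) P
  have e6 : (I.card : ℝ) + 1 ≤ 2 * (I.filter P).card := by exact_mod_cast hP
  rw [e1, ← e2]
  linarith

end Median

lemma infDist_Icc_le {a b y d : ℝ} (hab : a ≤ b) (hd : 0 ≤ d) (h1 : a - d ≤ y) (h2 : y ≤ b + d) :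
    Metric.infDist y (Icc a b) ≤ d := by
  have hmem : max a (min b y) ∈ Icc a b := ⟨le_max_left _ _, max_le hab (min_le_left _ _)⟩
  refine (Metric.infDist_le_dist_of_mem hmem).trans ?_
  rw [Real.dist_eq, abs_le]
  rcases le_total a y with h3 | h3
  · rw [max_eq_right (le_min hab h3)]
    rcases le_total b y with h4 | h4
    · rw [min_eq_left h4]; constructor <;> linarith
    · rw [min_eq_right h4]; constructor <;> linarith
  · rw [max_eq_left (min_le_of_right_le h3)]; constructor <;> linarith

/-! ### Asymptotics -/

section Asymptotics

variable {V : Type*} [Fintype V]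

/-- The arithmetic mean of the components of a vector. -/
noncomputable def mean (x : V → ℝ) : ℝ := (∑ i, x i) / Fintype.card V

lemma sum_sub_mean [Nonempty V] (x : V → ℝ) : ∑ i, (x i - mean x) = 0 := by
  have : (Fintype.card V : ℝ) ≠ 0 := Nat.cast_ne_zero.2 Fintype.card_ne_zero
  rw [Finset.sum_sub_distrib, Finset.sum_const, Finset.card_univ, nsmul_eq_mul, mean]
  field_simp
  ring

lemma hasDerivAt_mean {x : ℝ → V → ℝ} {v : V → ℝ} {t : ℝ} (hx : HasDerivAt x v t) :
    HasDerivAt (fun t => mean (x t)) (mean v) t :=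
  (HasDerivAt.fun_sum fun i _ => hasDerivAt_pi.1 hx i).div_const _

lemma absolutelyContinuousOnInterval_mean {x : ℝ → V → ℝ} {a b : ℝ}
    (hx : AbsolutelyContinuousOnInterval x a b) :
    AbsolutelyContinuousOnInterval (fun t => mean (x t)) a b := by
  have h := (absolutelyContinuousOnInterval_sum Finset.univ fun i =>
    absolutelyContinuousOnInterval_eval hx i).const_mul (Fintype.card V : ℝ)⁻¹
  refine (congrArg (AbsolutelyContinuousOnInterval · a b) (funext fun t => ?_)).mp h
  rw [mean, div_eq_inv_mul]

variable [DecidableEq V] {G : SimpleGraph V} [DecidableRel G.Adj] {s z : V → ℝ} {γ : ℝ}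

lemma mean_of_mem_solverSet {v p x : V → ℝ} (hv : ∀ i, v i = s i * p i + consensus G γ x i) :
    mean v = (∑ i, s i * p i) / Fintype.card V := by
  simp only [mean, hv, Finset.sum_add_distrib, sum_consensus, add_zero]

/-- The disagreement `|x - mean x|` decreases at a definite rate outside the ball of radius
`√N / (γ λ₂)`, where the consensus term dominates the bounded signs. -/
lemma eventually_sum_sub_mean_sq_le (hV : 2 ≤ Fintype.card V) (hG : G.Connected)
    (hs : ∀ i, s i = 0 ∨ s i = 1) (hγ : 0 < γ) {x : ℝ → V → ℝ}
    (hx : IsFilippovSolutionOn (medianSolver G s z γ) x (Ici 0)) {c : ℝ}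
    (hc : √(Fintype.card V) / (γ * algebraicConnectivity G hV) < c) :
    ∀ᶠ t in atTop, ∑ i, (x t i - mean (x t)) ^ 2 ≤ c ^ 2 := by
  have hne : Nonempty V := hG.nonempty
  have hρ : 0 < γ * algebraicConnectivity G hV :=
    mul_pos hγ (algebraicConnectivity_pos G hV hG)
  set ρ := γ * algebraicConnectivity G hV with hρ_def
  have hc0 : 0 < c := (by positivity : (0 : ℝ) ≤ _).trans_lt hc
  rw [div_lt_iff₀ hρ] at hc
  refine eventually_le_of_ae_decreasing (κ := 2 * c * (c * ρ - √(Fintype.card V))) (t₀ := 0)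
    (by have := sub_pos.2 hc; positivity) (fun a b ha hb => ?_) ?_
  · have h := hx.absolutelyContinuous a ha b hb
    simp only [sq]
    refine absolutelyContinuousOnInterval_sum _ fun i => ?_
    have h' := (absolutelyContinuousOnInterval_eval h i).fun_sub
      (absolutelyContinuousOnInterval_mean h)
    exact h'.fun_mul h'
  filter_upwards [ae_deriv_mem_solverSet hs measurableSet_Ici hx] with t ht ht0 hlarge
  obtain ⟨v, ⟨p, hp, hv⟩, hd⟩ := ht ht0
  refine ⟨_, ?_, hasDerivAt_sum_sub_sq hd
    (y := fun t _ => mean (x t)) (hasDerivAt_pi.2 fun _ => hasDerivAt_mean hd)⟩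
  set e : V → ℝ := fun i => x t i - mean (x t) with he
  have hesum : ∑ i, e i = 0 := sum_sub_mean (x t)
  have hAe : consensus G γ (x t) = consensus G γ e := by
    have : e = x t - fun _ => mean (x t) := rfl
    rw [this, map_sub, consensus_const, sub_zero]
  have h1 : ∑ i, (x t i - mean (x t)) * (v i - mean v) =
      ∑ i, e i * (s i * p i) + ∑ i, e i * consensus G γ e i := by
    have : ∑ i, e i * mean v = 0 := by rw [← Finset.sum_mul, hesum, zero_mul]
    rw [← sub_zero (∑ i, e i * (s i * p i) + _), ← this, ← Finset.sum_add_distrib,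
      ← Finset.sum_sub_distrib]
    refine Finset.sum_congr rfl fun i _ => ?_
    rw [hv, hAe]
    ring
  have h2 : ∑ i, e i * consensus G γ e i ≤ -ρ * ∑ i, e i ^ 2 :=
    sum_mul_consensus_le G hγ hV hG hesum
  have h3 : ∑ i, e i * (s i * p i) ≤ √(∑ i, e i ^ 2) * √(Fintype.card V) := by
    refine (Real.sum_mul_le_sqrt_mul_sqrt _ _ _).trans ?_
    gcongr
    have : ∑ _i : V, (1 : ℝ) = Fintype.card V := by simp
    rw [← this]
    refine Finset.sum_le_sum fun i _ => ?_
    rw [sq_le_one_iff_abs_le_one]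
    rcases hs i with h | h <;> simp [h, (hp i).1]
  set W := √(∑ i, e i ^ 2) with hW
  have hW2 : W ^ 2 = ∑ i, e i ^ 2 := Real.sq_sqrt (Finset.sum_nonneg fun i _ => sq_nonneg _)
  have hWc : c < W := Real.lt_sqrt_of_sq_lt hlarge
  rw [← hW2] at h2
  have h4 : c * (c * ρ - √(Fintype.card V)) ≤ W * (W * ρ - √(Fintype.card V)) := by
    have h5 : c * ρ ≤ W * ρ := by gcongr
    exact mul_le_mul hWc.le (by linarith) (by linarith) (hc0.trans hWc).le
  rw [h1]
  nlinarith

/-- Once every node is within `c` of the mean, a mean outside the `c`-neighbourhood of the median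
set is pushed back by a majority of equal signs. -/
lemma eventually_mean_mem (hs : ∀ i, s i = 0 ∨ s i = 1) (hV : 2 ≤ Fintype.card V)
    {x : ℝ → V → ℝ} (hx : IsFilippovSolutionOn (medianSolver G s z γ) x (Ici 0)) {a b c : ℝ}
    (hb : (Finset.univ.filter fun i => s i = 1).card <
        2 * ((Finset.univ.filter fun i => s i = 1).filter fun i => z i ≤ b).card)
    (ha : (Finset.univ.filter fun i => s i = 1).card <
        2 * ((Finset.univ.filter fun i => s i = 1).filter fun i => a ≤ z i).card)
    (hc : ∀ᶠ t in atTop, ∀ i, |x t i - mean (x t)| ≤ c) :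
    ∀ᶠ t in atTop, a - c ≤ mean (x t) ∧ mean (x t) ≤ b + c := by
  have hN : (0 : ℝ) < Fintype.card V := by exact_mod_cast (by omega : 0 < Fintype.card V)
  obtain ⟨t₀, ht₀⟩ := eventually_atTop.1 (hc.and (eventually_ge_atTop 0))
  have h00 : 0 ≤ t₀ := (ht₀ t₀ le_rfl).2
  have hac : ∀ r r', t₀ ≤ r → t₀ ≤ r' →
      AbsolutelyContinuousOnInterval (fun t => mean (x t)) r r' := fun r r' hr hr' =>
    absolutelyContinuousOnInterval_mean
      (hx.absolutelyContinuous r (h00.trans hr) r' (h00.trans hr'))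
  have hupper : ∀ᶠ t in atTop, mean (x t) ≤ b + c := by
    refine eventually_le_of_ae_decreasing (κ := 1 / Fintype.card V) (by positivity) hac ?_
    filter_upwards [ae_deriv_mem_solverSet hs measurableSet_Ici hx] with t ht htt hlarge
    obtain ⟨v, ⟨p, hp, hv⟩, hd⟩ := ht (h00.trans htt)
    refine ⟨_, ?_, hasDerivAt_mean hd⟩
    rw [mean_of_mem_solverSet hv, ← neg_div]
    gcongr
    refine sum_mul_le_neg_one hs hb (fun i => (abs_le.1 (hp i).1).2) fun i hi => ?_
    have := (abs_le.1 ((ht₀ t htt).1 i)).1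
    exact ((hp i).2.2 (by linarith)).le
  have hlower : ∀ᶠ t in atTop, -mean (x t) ≤ -(a - c) := by
    refine eventually_le_of_ae_decreasing (κ := 1 / Fintype.card V) (by positivity)
      (fun r r' hr hr' => (hac r r' hr hr').fun_neg) ?_
    filter_upwards [ae_deriv_mem_solverSet hs measurableSet_Ici hx] with t ht htt hlarge
    obtain ⟨v, ⟨p, hp, hv⟩, hd⟩ := ht (h00.trans htt)
    refine ⟨_, ?_, (hasDerivAt_mean hd).fun_neg⟩
    rw [mean_of_mem_solverSet hv, ← neg_div, ← neg_div, ← Finset.sum_neg_distrib]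
    gcongr
    simp only [← mul_neg]
    refine sum_mul_le_neg_one hs ha (fun i => by linarith [(abs_le.1 (hp i).1).1]) fun i hi => ?_
    have := (abs_le.1 ((ht₀ t htt).1 i)).2
    rw [(hp i).2.1 (by linarith)]
  filter_upwards [hupper, hlower] with t h1 h2
  exact ⟨by linarith, h1⟩

theorem limsup_infDist_medianSet_le (hV : 2 ≤ Fintype.card V) (hG : G.Connected)
    (hs : ∀ i, s i = 0 ∨ s i = 1) (hs1 : ∃ i, s i = 1) (hγ : 0 < γ) {x : ℝ → V → ℝ}
    (hx : IsFilippovSolutionOn (medianSolver G s z γ) x (Ici 0)) (i : V) :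
    limsup (fun t : ℝ => ((Metric.infDist (x t i) (medianSet s z) : ℝ) : EReal)) atTop ≤
      ((2 * √(Fintype.card V) / (γ * algebraicConnectivity G hV) : ℝ) : EReal) := by
  have hρ := mul_pos hγ (algebraicConnectivity_pos G hV hG)
  refine EReal.le_of_forall_lt_iff_le.1 fun r hr => ?_
  have hr' : √(Fintype.card V) / (γ * algebraicConnectivity G hV) < r / 2 := by
    have := EReal.coe_lt_coe_iff.1 hr
    rw [mul_div_assoc] at this
    linarith
  have hr0 : 0 < r / 2 := (by positivity : (0 : ℝ) ≤ _).trans_lt hr'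
  have hdev : ∀ᶠ t in atTop, ∀ j, |x t j - mean (x t)| ≤ r / 2 := by
    filter_upwards [eventually_sum_sub_mean_sq_le hV hG hs hγ hx hr'] with t ht j
    refine abs_le_of_sq_le_sq ?_ hr0.le
    exact (Finset.single_le_sum (f := fun j => (x t j - mean (x t)) ^ 2)
      (fun i _ => sq_nonneg _) (Finset.mem_univ j)).trans ht
  obtain ⟨a, b, hab, hmed, hb, ha⟩ := exists_medianSet_eq_Icc s z hs1
  refine limsup_le_of_le (h := ?_)
  filter_upwards [hdev, eventually_mean_mem hs hV hx hb ha hdev] with t h1 h2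
  rw [EReal.coe_le_coe_iff, hmed]
  have h3 := abs_le.1 (h1 i)
  exact infDist_Icc_le hab (by linarith) (by linarith) (by linarith)

end Asymptotics

end MedianSolver

theorem theorem1 {V : Type*} [Fintype V] [DecidableEq V] (hV : 2 ≤ Fintype.card V)
    (G : SimpleGraph V) [DecidableRel G.Adj] (hG : G.Connected)
    (s z : V → ℝ) (hs : ∀ i, s i = 0 ∨ s i = 1) (hs1 : ∃ i, s i = 1)
    (γ : ℝ) (hγ : 0 < γ) :
    -- from every initial condition there is a Filippov solution on `[0, ∞)`
    (∀ x₀ : V → ℝ, ∃ x : ℝ → V → ℝ,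
      IsFilippovSolutionOn (medianSolver G s z γ) x (Set.Ici 0) ∧ x 0 = x₀) ∧
    -- every Filippov solution on a bounded interval `[0, T)` extends to one on `[0, ∞)`
    (∀ (T : ℝ) (x : ℝ → V → ℝ), 0 < T →
      IsFilippovSolutionOn (medianSolver G s z γ) x (Set.Ico 0 T) →
      ∃ y : ℝ → V → ℝ, IsFilippovSolutionOn (medianSolver G s z γ) y (Set.Ici 0) ∧
        Set.EqOn y x (Set.Ico 0 T)) ∧
    -- every Filippov solution on `[0, ∞)` satisfies the asymptotic bound
    (∀ x : ℝ → V → ℝ, IsFilippovSolutionOn (medianSolver G s z γ) x (Set.Ici 0) →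
      ∀ i : V,
        limsup (fun t : ℝ => ((Metric.infDist (x t i) (medianSet s z) : ℝ) : EReal)) atTop ≤
          ((2 * Real.sqrt (Fintype.card V) / (γ * algebraicConnectivity G hV) : ℝ) : EReal)) :=
  ⟨MedianSolver.exists_isFilippovSolutionOn hs hγ,
    fun _ _ _ hx => MedianSolver.exists_extension hs hγ hx,
    fun _ hx i => MedianSolver.limsup_infDist_medianSet_le hV hG hs hs1 hγ hx i⟩
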